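/- Let $\zeta$ be the Riemann zeta-function, $\mu$ the Möbius function, $\varphi$ Euler's function, and $\nu_p(m)$ the exponent of the prime $p$ in $m$. For integers $k,n\ge 1$ let $d_k(n)$ be the number of ordered factorizations of $n$ into $k$ positive integer factors. For real $x\ge 1$ put $$\Delta_k(x)=\sum_{n\le x}d_k(n)-x\,\mathop{\mathrm{Res}}_{s=1}\Big(\zeta(s)^k\frac{x^{s-1}}{s}\Big),\qquad \beta_k=\inf\Big\{b\in\mathbb R:\int_1^X|\Delta_k(x)|^2\,dx\ll X^{1+2b}\ (X\to\infty)\Big\}.$$ For integers $q,h\ge 1$ let $c_q(h)=\sum_{d\mid (h,q)}d\,\mu(q/d)$ be the Ramanujan sum. For $e\mid d\mid q$ and $\mathrm{Re}\,s>0$ put $$\Psi_{d,e}(s,q,k)=\frac{d\,\mu(d)\mu(e)}{\varphi(d)\,e}\prod_{p\mid (eq/d)}\Big\{\Big(1-\frac1{p^{s}}\Big)^k\sum_{\nu=0}^\infty\frac{d_k\big(p^{\nu+\nu_p(eq/d)}\big)}{p^{\nu s}}\Big\},$$ and for real $x\ge 1$ put $$Q_k(x,q)=\frac1{2\pi i}\int_{|s-1|=1/8}\zeta(s)^k\sum_{d\mid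 q}\sum_{e\mid d}\Psi_{d,e}(s,q,k)\Big(\frac{ex}{dq}\Big)^{s-1}ds,\qquad \mathfrak S_k(x,h)=\sum_{q=1}^\infty\frac{c_q(h)}{q^2}\,Q_k(x,q)^2 .$$ Finally, for real $N\ge 1$ and integers $h\ge 1$ let $$\Delta_k(N;h)=\sum_{N<n\le 2N}d_k(n)\,d_k(n+h)-\int_N^{2N}\mathfrak S_k(x,h)\,dx .$$ **Theorem.** Let $k\ge 3$ be an integer and let $\varepsilon>0$. There is a constant $C$, depending only on $k$ and $\varepsilon$, such that for all real $N,H$ with $1\le H\le N$, $$\Big|\sum_{1\le h\le H}\Delta_k(N;h)\Big|\le C\,N^{\varepsilon}\big(H^2+N^{1+\beta_k}\big).$$ -/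

import Mathlib

open Filter Topology MeasureTheory Asymptotics

noncomputable section

namespace AdditiveDivisor

/-- The generalized divisor function `d_k(n)`: the number of (ordered) ways of writing `n` as a
product of `k` positive integers. -/
def divFun (k n : ℕ) : ℕ := (Nat.finMulAntidiag k n).card

/-- The residue of `f` at the isolated singularity `z₀`: the limit as `r → 0+` of
`(2πi)⁻¹ ∮_{|z - z₀| = r} f(z) dz` (for an isolated singularity the integral does not depend on
`r` once `r` is small). -/
def residue (f : ℂ → ℂ) (z₀ : ℂ) : ℂ :=
  limUnder (𝓝[>] (0 : ℝ))
    (fun r : ℝ => (2 * (Real.pi : ℂ) * Complex.I)⁻¹ * ∮ z in C(z₀, r), f z)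

/-- The summatory function `D_k(x) = ∑_{n ≤ x} d_k(n)`. -/
def divSum (k : ℕ) (x : ℝ) : ℕ := ∑ n ∈ Finset.Icc 1 ⌊x⌋₊, divFun k n

/-- `p_{k-1}(log x) = Res_{s=1} ζ(s)^k x^{s-1} / s`, for `x > 0`. -/
def mainPoly (k : ℕ) (x : ℝ) : ℂ :=
  residue (fun s : ℂ => riemannZeta s ^ k * ((x : ℂ) ^ (s - 1) / s)) 1

/-- The error term `Δ_k(x) = D_k(x) - x p_{k-1}(log x)` of the general divisor problem. -/
def divErr (k : ℕ) (x : ℝ) : ℂ := (divSum k x : ℂ) - (x : ℂ) * mainPoly k x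

/-- The mean-square exponent
`β_k = inf {b : ∫_1^X |Δ_k(x)|² dx ≪ X^{1+2b}}`. -/
def beta (k : ℕ) : ℝ :=
  sInf {b : ℝ | (fun X : ℝ => ∫ x in (1 : ℝ)..X, ‖divErr k x‖ ^ 2)
    =O[atTop] fun X : ℝ => X ^ (1 + 2 * b)}

/-- The Ramanujan sum `c_q(h) = ∑_{d ∣ (h,q)} d μ(q/d)`. -/
def ramanujanSum (q h : ℕ) : ℤ :=
  ∑ d ∈ (Nat.gcd h q).divisors, (d : ℤ) * ArithmeticFunction.moebius (q / d)

/-- `Ψ_{d,e}(s,q,k)`, used only for `e ∣ d ∣ q`, so that `e * q / d` is an exact quotient. -/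
def Psi (d e : ℕ) (s : ℂ) (q k : ℕ) : ℂ :=
  ((d : ℂ) * (ArithmeticFunction.moebius d : ℂ) * (ArithmeticFunction.moebius e : ℂ)
      / ((Nat.totient d : ℂ) * (e : ℂ))) *
    ∏ p ∈ (e * q / d).primeFactors,
      ((1 - 1 / (p : ℂ) ^ s) ^ k *
        ∑' ν : ℕ, (divFun k (p ^ (ν + padicValNat p (e * q / d))) : ℂ) / (p : ℂ) ^ ((ν : ℂ) * s))

/-- `Q_k(x,q)`, the integral `(2πi)⁻¹ ∮_{|s-1|=1/8}` of
`ζ(s)^k ∑_{d ∣ q} ∑_{e ∣ d} Ψ_{d,e}(s,q,k) (ex/(dq))^{s-1}`. -/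
def Q (k : ℕ) (x : ℝ) (q : ℕ) : ℂ :=
  (2 * (Real.pi : ℂ) * Complex.I)⁻¹ *
    ∮ s in C(1, 1 / 8), riemannZeta s ^ k *
      ∑ d ∈ q.divisors, ∑ e ∈ d.divisors,
        Psi d e s q k * ((((e : ℝ) * x / ((d : ℝ) * (q : ℝ)) : ℝ) : ℂ) ^ (s - 1))

/-- The singular series `𝔖_k(x,h) = ∑_{q ≥ 1} c_q(h) q⁻² Q_k(x,q)²`. -/
def singSeries (k : ℕ) (x : ℝ) (h : ℕ) : ℂ :=
  ∑' q : ℕ+, (ramanujanSum (q : ℕ) h : ℂ) / ((q : ℕ) : ℂ) ^ 2 * Q k x (q : ℕ) ^ 2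

/-- The correlation sum `D_k(N,h) = ∑_{N < n ≤ 2N} d_k(n) d_k(n+h)`, for `N ≥ 0`. -/
def corrSum (k : ℕ) (N : ℝ) (h : ℕ) : ℕ :=
  ∑ n ∈ Finset.Ioc ⌊N⌋₊ ⌊2 * N⌋₊, divFun k n * divFun k (n + h)

/-- The error term `Δ_k(N;h) = D_k(N,h) - ∫_N^{2N} 𝔖_k(x,h) dx` of the additive divisor problem. -/
def corrErr (k : ℕ) (N : ℝ) (h : ℕ) : ℂ :=
  (corrSum k N h : ℂ) - ∫ x in N..(2 * N), singSeries k x h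

end AdditiveDivisor

end

noncomputable section

namespace AdditiveDivisor

/-! ### Divisor bounds -/

/-! Summing over the shift decouples the correlation. With `L = ⌊H⌋`, the sum of `corrSum k N h`
over `1 ≤ h ≤ L` is `∑ d_k(n) (D_k(n + L) - D_k(n))` over `N < n ≤ 2N` (`sum_corrSum`), so only the
one-variable divisor problem is needed. Write `D_k = M + Δ_k`, with `M` the residue main term.

The part `Δ_k(n + L) - Δ_k(n)` is bounded in absolute value. The function `Δ_k` varies by at most
`X^δ` times length plus one, so a sum of `|Δ_k|` over integers is comparable to an integral, and the
mean square bounds that by `N^(1+b)` for any admissible exponent `b`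
(`exists_integral_norm_divErr_le`, `exists_sum_norm_divErr_le`).

In `M(n + L) - M(n) = L M'(n) + O(L² N^(δ-1))` the remainder contributes `L²` up to `N^(2δ)`.
Partial summation turns `∑ d_k(n) M'(n)` into `∫ M'²`, up to endpoint terms `M' Δ_k` and the
integral of `M'' Δ_k` (`sum_divFun_mul_mainDeriv`). After multiplication by `L`, the endpoint terms
are handled by averaging over a window of length `L`, at a cost of `L²`, and the integral is small
because `M'' ≪ N^(δ-1)` and `L ≤ N`.

On the other side, the term `q = 1` of the singular series is exactly `M'(x)²` (`Q_one`). For `q ≥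
2` Ramanujan sums cancel over `h`, their sum being at most `τ(q) min(q, L)`. Together with `Q_k(x,q)
≪ (xq)^δ` this leaves only `(xL)^δ` (`exists_norm_sum_singSeries_sub_le`). The two main terms `L ∫
M'²` therefore agree.

Finally, every admissible `b` is nonnegative, because `Δ_k` jumps at each integer, so errors of size
`N^(1+2δ)` are absorbed; and `b` can be taken arbitrarily close to `β_k`. -/

lemma exists_succ_le_mul_rpow {δ : ℝ} (hδ : 0 < δ) :
    ∃ A : ℝ, 1 ≤ A ∧ ∀ (x : ℝ) (a : ℕ), 2 ≤ x → (a + 1 : ℝ) ≤ A * (x ^ δ) ^ a := by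
  have h2 : 0 < δ * Real.log 2 := mul_pos hδ (Real.log_pos one_lt_two)
  -- Bernoulli gives `x^(δa) ≥ 1 + a δ log 2`; the constant scales the slope `δ log 2` up to at
  -- least `1`.
  refine ⟨max 1 (1 / (δ * Real.log 2)), le_max_left _ _, fun x a hx => ?_⟩
  have hx0 : 0 < x := by linarith
  have h1 : 1 + a * (δ * Real.log 2) ≤ (x ^ δ) ^ a := by
    have h3 : (1 + δ * Real.log 2) ≤ x ^ δ := by
      rw [Real.rpow_def_of_pos hx0]
      have := Real.add_one_le_exp (Real.log x * δ)
      have h4 : Real.log 2 ≤ Real.log x := Real.log_le_log two_pos hx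
      nlinarith
    have h5 := one_add_mul_le_pow (a := δ * Real.log 2) (by linarith) a
    exact h5.trans (pow_le_pow_left₀ (by linarith) h3 a)
  set A := max 1 (1 / (δ * Real.log 2)) with hA
  have hA1 : 1 ≤ A := le_max_left _ _
  have hA2 : 1 ≤ A * (δ * Real.log 2) := by
    have : 1 / (δ * Real.log 2) ≤ A := le_max_right _ _
    rwa [div_le_iff₀ h2] at this
  have ha : (0 : ℝ) ≤ a := Nat.cast_nonneg a
  calc (a + 1 : ℝ) ≤ A * (1 + a * (δ * Real.log 2)) := by nlinarith
    _ ≤ _ := by gcongr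

lemma prod_primeFactors_rpow_pow {n : ℕ} (hn : n ≠ 0) (δ : ℝ) :
    ∏ p ∈ n.primeFactors, ((p : ℝ) ^ δ) ^ (n.factorization p) = (n : ℝ) ^ δ := by
  conv_rhs => rw [← Nat.prod_factorization_pow_eq_self hn]
  rw [Finsupp.prod, Nat.support_factorization, Nat.cast_prod,
    ← Real.finsetProd_rpow _ _ (fun i _ => by positivity)]
  refine Finset.prod_congr rfl fun p _ => ?_
  rw [Nat.cast_pow, ← Real.rpow_natCast, ← Real.rpow_natCast, ← Real.rpow_mul (by positivity),
    ← Real.rpow_mul (by positivity), mul_comm]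

/-- The classical argument: if `p ≥ 2^(1/δ)` then `a + 1 ≤ 2^a ≤ p^(δa)` with no loss, and each of
the fewer than `P` smaller primes loses at most a factor `A`. -/
theorem exists_card_divisors_le {δ : ℝ} (hδ : 0 < δ) :
    ∃ C : ℝ, 0 < C ∧ ∀ n : ℕ, n ≠ 0 → (n.divisors.card : ℝ) ≤ C * (n : ℝ) ^ δ := by
  obtain ⟨A, hA1, hA⟩ := exists_succ_le_mul_rpow hδ
  set P : ℕ := ⌈(2 : ℝ) ^ (1 / δ)⌉₊ with hP
  refine ⟨A ^ P, by positivity, fun n hn => ?_⟩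
  rw [Nat.card_divisors hn, Nat.cast_prod, ← prod_primeFactors_rpow_pow hn δ]
  have key : ∀ p ∈ n.primeFactors, ((n.factorization p + 1 : ℕ) : ℝ) ≤
      (if p < P then A else 1) * ((p : ℝ) ^ δ) ^ (n.factorization p) := by
    intro p hp
    have hp2 : (2 : ℝ) ≤ p := by exact_mod_cast (Nat.prime_of_mem_primeFactors hp).two_le
    push_cast
    split_ifs with h
    · exact hA _ _ hp2
    · have h1 : (2 : ℝ) ^ (1 / δ) ≤ p := (Nat.le_ceil _).trans (by exact_mod_cast not_lt.1 h)
      have h2 : (2 : ℝ) ≤ (p : ℝ) ^ δ := by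
        calc (2 : ℝ) = ((2 : ℝ) ^ (1 / δ)) ^ δ := by
              rw [← Real.rpow_mul (by norm_num), one_div_mul_cancel hδ.ne', Real.rpow_one]
          _ ≤ _ := by gcongr
      rw [one_mul]
      calc ((n.factorization p : ℝ) + 1) ≤ 2 ^ (n.factorization p) := by
            exact_mod_cast Nat.lt_two_pow_self
        _ ≤ _ := by gcongr
  refine (Finset.prod_le_prod (fun _ _ => by positivity) key).trans ?_
  rw [Finset.prod_mul_distrib]
  gcongr
  rw [Finset.prod_ite, Finset.prod_const, Finset.prod_const_one, mul_one]
  refine pow_le_pow_right₀ hA1 ?_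
  calc _ ≤ (Finset.range P).card := Finset.card_le_card fun p hp => by
        simpa using (Finset.mem_filter.1 hp).2
    _ = P := Finset.card_range P

lemma two_pow_card_primeFactors_le {n : ℕ} (hn : n ≠ 0) :
    2 ^ n.primeFactors.card ≤ n.divisors.card := by
  rw [Nat.card_divisors hn, ← Finset.prod_const]
  refine Finset.prod_le_prod' fun p hp => ?_
  have := (Nat.prime_of_mem_primeFactors hp).factorization_pos_of_dvd hn
    (Nat.dvd_of_mem_primeFactors hp)
  omega

theorem exists_card_divisors_pow_le (j : ℕ) {δ : ℝ} (hδ : 0 < δ) :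
    ∃ C : ℝ, 0 < C ∧ ∀ n : ℕ, n ≠ 0 → (n.divisors.card : ℝ) ^ j ≤ C * (n : ℝ) ^ δ := by
  obtain ⟨C, hC0, hC⟩ := exists_card_divisors_le (δ := δ / (j + 1)) (by positivity)
  refine ⟨C ^ j, by positivity, fun n hn => ?_⟩
  have hn1 : (1 : ℝ) ≤ n := by exact_mod_cast Nat.one_le_iff_ne_zero.2 hn
  calc (n.divisors.card : ℝ) ^ j ≤ (C * (n : ℝ) ^ (δ / (j + 1))) ^ j := by
        gcongr; exact hC n hn
    _ = C ^ j * (n : ℝ) ^ (δ / (j + 1) * j) := by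
        rw [mul_pow, ← Real.rpow_natCast ((n : ℝ) ^ _), ← Real.rpow_mul (by positivity)]
    _ ≤ C ^ j * (n : ℝ) ^ δ := by
        gcongr
        rw [div_mul_eq_mul_div, div_le_iff₀ (by positivity)]; nlinarith

/-- With `B < 2^j` one has `B^ω(n) ≤ (2^ω(n))^j ≤ τ(n)^j`. This absorbs a bounded loss at every
prime of an Euler product. -/
theorem exists_pow_card_primeFactors_le (B : ℝ) (hB : 0 ≤ B) {δ : ℝ} (hδ : 0 < δ) :
    ∃ C : ℝ, 0 < C ∧ ∀ n : ℕ, n ≠ 0 → B ^ n.primeFactors.card ≤ C * (n : ℝ) ^ δ := by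
  obtain ⟨j, hj⟩ := pow_unbounded_of_one_lt B one_lt_two
  obtain ⟨C, hC0, hC⟩ := exists_card_divisors_pow_le j hδ
  refine ⟨C, hC0, fun n hn => le_trans ?_ (hC n hn)⟩
  calc B ^ n.primeFactors.card ≤ (2 ^ j) ^ n.primeFactors.card := by gcongr
    _ = (2 ^ n.primeFactors.card) ^ j := by rw [← pow_mul, ← pow_mul, mul_comm]
    _ ≤ _ := by
      gcongr
      exact_mod_cast two_pow_card_primeFactors_le hn

lemma divFun_zero_right (k : ℕ) : divFun k 0 = 0 := by
  simp [divFun]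

lemma divFun_pos {k n : ℕ} (hk : k ≠ 0) (hn : n ≠ 0) : 1 ≤ divFun k n := by
  obtain ⟨k, rfl⟩ := Nat.exists_eq_succ_of_ne_zero hk
  refine Finset.card_pos.2 ⟨Fin.cons n fun _ => 1, ?_⟩
  simp [Nat.mem_finMulAntidiag, Fin.prod_univ_succ, hn]

lemma divFun_le_card_divisors_pow {k n : ℕ} (hn : n ≠ 0) :
    divFun k n ≤ n.divisors.card ^ k := by
  calc divFun k n ≤ (Fintype.piFinset fun _ : Fin k => n.divisors).card := by
        refine Finset.card_le_card fun f hf => ?_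
        rw [Fintype.mem_piFinset]
        exact fun i => Nat.mem_divisors.2 ⟨Nat.dvd_of_mem_finMulAntidiag hf i, hn⟩
    _ = _ := by simp

theorem exists_divFun_le (k : ℕ) {δ : ℝ} (hδ : 0 < δ) :
    ∃ C : ℝ, 0 < C ∧ ∀ n : ℕ, n ≠ 0 → (divFun k n : ℝ) ≤ C * (n : ℝ) ^ δ := by
  obtain ⟨C, hC0, hC⟩ := exists_card_divisors_pow_le k hδ
  refine ⟨C, hC0, fun n hn => le_trans ?_ (hC n hn)⟩
  exact_mod_cast divFun_le_card_divisors_pow hn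

/-- Since `p / (p - 1) ≤ 2`, the quotient `d / φ(d)` is at most `2^ω(d)`. -/
lemma cast_div_totient_le {d : ℕ} (hd : d ≠ 0) :
    (d : ℝ) / d.totient ≤ d.divisors.card := by
  have hpos : (0 : ℝ) < d.totient := by exact_mod_cast Nat.totient_pos.2 (Nat.pos_of_ne_zero hd)
  have hP : (0 : ℝ) < ((∏ p ∈ d.primeFactors, p : ℕ) : ℝ) := by
    exact_mod_cast Finset.prod_pos fun p hp => (Nat.prime_of_mem_primeFactors hp).pos
  have h1 := Nat.totient_mul_prod_primeFactors d
  have h2 : ∏ p ∈ d.primeFactors, p ≤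
      2 ^ d.primeFactors.card * ∏ p ∈ d.primeFactors, (p - 1) := by
    rw [← Finset.prod_const, ← Finset.prod_mul_distrib]
    refine Finset.prod_le_prod' fun p hp => ?_
    have := (Nat.prime_of_mem_primeFactors hp).two_le
    omega
  rw [div_le_iff₀ hpos]
  have h3 : d * ∏ p ∈ d.primeFactors, p ≤
      (d.divisors.card * d.totient) * ∏ p ∈ d.primeFactors, p := by
    calc d * ∏ p ∈ d.primeFactors, p
        ≤ d * (2 ^ d.primeFactors.card * ∏ p ∈ d.primeFactors, (p - 1)) := by gcongr
      _ = 2 ^ d.primeFactors.card * (d.totient * ∏ p ∈ d.primeFactors, p) := by rw [h1]; ring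
      _ ≤ d.divisors.card * (d.totient * ∏ p ∈ d.primeFactors, p) := by
        gcongr; exact two_pow_card_primeFactors_le hd
      _ = _ := by ring
  have h4 : d ≤ d.divisors.card * d.totient :=
    Nat.le_of_mul_le_mul_right h3 (by exact_mod_cast hP)
  exact_mod_cast h4

/-! ### Contour integrals around `s = 1` -/

/-- The normalized integral `(2πi)⁻¹ ∮_{|s-1|=r} F(s) ds`. -/
def loop (r : ℝ) (F : ℂ → ℂ) : ℂ :=
  (2 * (Real.pi : ℂ) * Complex.I)⁻¹ * ∮ s in C(1, r), F s

/-- `F` is holomorphic on the punctured closed disc `0 < |s - 1| ≤ 1/8`. -/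
def PuncturedHolo (F : ℂ → ℂ) : Prop :=
  ∀ s : ℂ, s ≠ 1 → ‖s - 1‖ ≤ 1 / 8 → DifferentiableAt ℂ F s

lemma PuncturedHolo.mul {F G : ℂ → ℂ} (hF : PuncturedHolo F) (hG : PuncturedHolo G) :
    PuncturedHolo fun s => F s * G s :=
  fun s h1 h2 => (hF s h1 h2).mul (hG s h1 h2)

lemma puncturedHolo_zeta_pow (k : ℕ) : PuncturedHolo fun s => riemannZeta s ^ k :=
  fun _ h1 _ => (differentiableAt_riemannZeta h1).pow k

lemma puncturedHolo_cpow {x : ℝ} (hx : 0 < x) (c : ℂ) :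
    PuncturedHolo fun s => (x : ℂ) ^ (s - c) := fun s _ _ => by
  have hx0 : (x : ℂ) ≠ 0 := by exact_mod_cast hx.ne'
  exact (differentiableAt_id.sub_const c).const_cpow (Or.inl hx0)

lemma seven_eighths_le_re {s : ℂ} (h : ‖s - 1‖ ≤ 1 / 8) : 7 / 8 ≤ s.re := by
  have h1 := (abs_le.1 ((Complex.abs_re_le_norm (s - 1)).trans h)).1
  simp only [Complex.sub_re, Complex.one_re] at h1
  linarith

lemma ne_zero_of_norm_sub_one_le {s : ℂ} (h : ‖s - 1‖ ≤ 1 / 8) : s ≠ 0 := fun h0 => by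
  have := seven_eighths_le_re h
  rw [h0, Complex.zero_re] at this
  norm_num at this

lemma puncturedHolo_zeta_pow_div (k : ℕ) : PuncturedHolo fun s => riemannZeta s ^ k / s :=
  fun s h1 h2 => (puncturedHolo_zeta_pow k s h1 h2).div differentiableAt_id
    (ne_zero_of_norm_sub_one_le h2)

/-- Cauchy's theorem on the annulus. Shrinking the circle is what makes a factor `x^(s-1)` cost only
`x^r` with `r` arbitrarily small. -/
lemma loop_eq_of_puncturedHolo {F : ℂ → ℂ} (hF : PuncturedHolo F) {r : ℝ} (h0 : 0 < r)
    (hr : r ≤ 1 / 8) : loop r F = loop (1 / 8) F := by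
  unfold loop
  rw [Complex.circleIntegral_eq_of_differentiable_on_annulus_off_countable h0 hr
    Set.countable_empty]
  · intro z hz
    simp only [Set.mem_sdiff, Metric.mem_closedBall, Metric.mem_ball, not_lt, dist_eq_norm] at hz
    refine (hF z ?_ hz.1).continuousAt.continuousWithinAt
    rintro rfl
    simp at hz
    linarith
  · intro z hz
    simp only [Set.mem_sdiff, Metric.mem_closedBall, Metric.mem_ball, dist_eq_norm] at hz
    refine hF z ?_ hz.1.1.le
    rintro rfl
    simp at hz
    linarith

lemma norm_loop_le {F : ℂ → ℂ} {r B : ℝ} (hr : 0 ≤ r)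
    (hB : ∀ s : ℂ, ‖s - 1‖ = r → ‖F s‖ ≤ B) : ‖loop r F‖ ≤ r * B := by
  have := circleIntegral.norm_two_pi_i_inv_smul_integral_le_of_norm_le_const (f := F) (c := 1)
    hr (fun z hz => hB z (by simpa [dist_eq_norm] using hz))
  simpa [loop] using this

/-- The integral is constant in the radius on `(0, 1/8]`, so the limit defining the residue exists.
-/
lemma residue_eq_loop {F : ℂ → ℂ} (hF : PuncturedHolo F) : residue F 1 = loop (1 / 8) F := by
  unfold residue
  refine Tendsto.limUnder_eq ?_
  refine Tendsto.congr' ?_ tendsto_const_nhds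
  have : Set.Ioc (0 : ℝ) (1 / 8) ∈ 𝓝[>] (0 : ℝ) := Ioc_mem_nhdsGT (by norm_num)
  filter_upwards [this] with r hr
  exact (loop_eq_of_puncturedHolo hF hr.1 hr.2).symm

lemma loop_congr {F G : ℂ → ℂ} {r : ℝ} (hr : 0 ≤ r)
    (h : ∀ s : ℂ, ‖s - 1‖ = r → F s = G s) : loop r F = loop r G := by
  unfold loop
  congr 1
  exact circleIntegral.integral_congr hr fun s hs => h s (by simpa [dist_eq_norm] using hs)

lemma const_mul_loop (a : ℂ) (r : ℝ) (F : ℂ → ℂ) : a * loop r F = loop r fun s => a * F s := by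
  unfold loop
  rw [circleIntegral.integral_const_mul]
  ring

theorem hasDerivAt_loop_cpow {G : ℂ → ℂ} {r : ℝ} (hr : 0 ≤ r)
    (hG : ContinuousOn G (Metric.sphere 1 r)) (c : ℂ) {x : ℝ} (hx : 0 < x) :
    HasDerivAt (fun y : ℝ => loop r fun s => G s * (y : ℂ) ^ (s - c))
      (loop r fun s => G s * ((s - c) * (x : ℂ) ^ (s - c - 1))) x := by
  unfold loop circleIntegral
  have hGc : Continuous fun θ => G (circleMap 1 r θ) :=
    hG.comp_continuous (continuous_circleMap 1 r) (circleMap_mem_sphere 1 hr)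
  have hd : Continuous fun θ => deriv (circleMap 1 r) θ := by
    simp only [deriv_circleMap]
    exact (continuous_circleMap 0 r).mul continuous_const
  have hcm : Continuous (circleMap 1 r) := continuous_circleMap 1 r
  have hFc : ∀ (a : ℂ) (y : ℝ), 0 < y → Continuous fun θ => (y : ℂ) ^ (circleMap 1 r θ - a) := by
    intro a y hy
    have hy0 : (y : ℂ) ≠ 0 := by exact_mod_cast hy.ne'
    exact (hcm.sub continuous_const).const_cpow (Or.inl hy0)
  have hF'c : ∀ y : ℝ, 0 < y → Continuous fun θ => deriv (circleMap 1 r) θ •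
      (G (circleMap 1 r θ) * ((circleMap 1 r θ - c) * (y : ℂ) ^ (circleMap 1 r θ - c - 1))) := by
    intro y hy
    refine hd.smul (hGc.mul ((hcm.sub continuous_const).mul ?_))
    simpa only [sub_sub] using hFc (c + 1) y hy
  -- On this compact rectangle the differentiated integrand is continuous, hence bounded; the bound
  -- is the dominating function for differentiation under the integral.
  set K : Set (ℝ × ℝ) := Set.Icc (x / 2) (2 * x) ×ˢ Set.Icc 0 (2 * Real.pi)
  have hK : IsCompact K := isCompact_Icc.prod isCompact_Icc
  have hcont : ContinuousOn (fun p : ℝ × ℝ => deriv (circleMap 1 r) p.2 •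
      (G (circleMap 1 r p.2) * ((circleMap 1 r p.2 - c) *
        (p.1 : ℂ) ^ (circleMap 1 r p.2 - c - 1)))) K := by
    refine (hd.comp continuous_snd).continuousOn.smul
      ((hGc.comp continuous_snd).continuousOn.mul
        (((hcm.comp continuous_snd).sub continuous_const).continuousOn.mul ?_))
    refine ContinuousOn.cpow (Complex.continuous_ofReal.comp continuous_fst).continuousOn
      ((((hcm.comp continuous_snd).sub continuous_const).sub continuous_const).continuousOn) ?_
    rintro ⟨y, θ⟩ hy
    refine Complex.ofReal_mem_slitPlane.2 ?_
    have := hy.1.1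
    simp only at this ⊢
    linarith
  obtain ⟨B, hB⟩ := hK.exists_bound_of_continuousOn hcont
  refine HasDerivAt.const_mul _ ?_
  refine (intervalIntegral.hasDerivAt_integral_of_dominated_loc_of_deriv_le
    (s := Set.Ioo (x / 2) (2 * x)) (bound := fun _ => B)
    (F := fun (y : ℝ) θ => deriv (circleMap 1 r) θ •
      (G (circleMap 1 r θ) * (y : ℂ) ^ (circleMap 1 r θ - c)))
    (F' := fun (y : ℝ) θ => deriv (circleMap 1 r) θ •
      (G (circleMap 1 r θ) * ((circleMap 1 r θ - c) * (y : ℂ) ^ (circleMap 1 r θ - c - 1))))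
    (Ioo_mem_nhds (by linarith) (by linarith)) ?_ ?_ ?_ ?_ ?_ ?_).2
  · filter_upwards [lt_mem_nhds hx] with y hy
    exact (hd.smul (hGc.mul (hFc c y hy))).aestronglyMeasurable
  · exact (hd.smul (hGc.mul (hFc c x hx))).intervalIntegrable _ _
  · exact (hF'c x hx).aestronglyMeasurable
  · refine Eventually.of_forall fun θ hθ y hy => ?_
    rw [Set.uIoc_of_le (by positivity)] at hθ
    exact hB (y, θ) ⟨⟨hy.1.le, hy.2.le⟩, ⟨hθ.1.le, hθ.2⟩⟩
  · exact intervalIntegrable_const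
  · refine Eventually.of_forall fun θ _ y hy => ?_
    have hy0 : 0 < y := by linarith [hy.1]
    have h1 : HasDerivAt (fun y : ℝ => (y : ℂ) ^ (circleMap 1 r θ - c))
        ((circleMap 1 r θ - c) * (y : ℂ) ^ (circleMap 1 r θ - c - 1)) y := by
      have h2 := (hasDerivAt_id (y : ℂ)).cpow_const (c := circleMap 1 r θ - c)
        (Complex.ofReal_mem_slitPlane.2 hy0)
      simpa using h2.comp_ofReal
    exact (h1.const_mul (G (circleMap 1 r θ))).const_mul (deriv (circleMap 1 r) θ)

lemma PuncturedHolo.continuousOn_sphere {G : ℂ → ℂ} (hG : PuncturedHolo G) {r : ℝ} (h0 : 0 < r)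
    (hr : r ≤ 1 / 8) : ContinuousOn G (Metric.sphere 1 r) := fun s hs => by
  have hs' : ‖s - 1‖ = r := by simpa [dist_eq_norm] using hs
  refine (hG s ?_ (by linarith)).continuousAt.continuousWithinAt
  rintro rfl
  simp at hs'
  linarith

/-- On `|s - 1| = r` the real part of `s - c` is at most `r + (1 - c)`, and `G` is bounded there
independently of `x`. -/
theorem exists_norm_loop_cpow_le {G : ℂ → ℂ} (hG : PuncturedHolo G) (c : ℝ) {r : ℝ} (h0 : 0 < r)
    (hr : r ≤ 1 / 8) : ∃ C : ℝ, 0 < C ∧ ∀ x : ℝ, 1 ≤ x →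
      ‖loop (1 / 8) fun s => G s * (x : ℂ) ^ (s - c)‖ ≤ C * x ^ (r + (1 - c)) := by
  obtain ⟨B, hB⟩ := (isCompact_sphere (1 : ℂ) r).exists_bound_of_continuousOn
    (hG.continuousOn_sphere h0 hr)
  refine ⟨r * (|B| + 1), by positivity, fun x hx => ?_⟩
  have hx0 : 0 < x := by linarith
  rw [← loop_eq_of_puncturedHolo (hG.mul (puncturedHolo_cpow hx0 c)) h0 hr, mul_assoc]
  refine norm_loop_le h0.le fun s hs => ?_
  rw [norm_mul, Complex.norm_cpow_eq_rpow_re_of_pos hx0]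
  have h1 : ‖G s‖ ≤ |B| + 1 := by
    linarith [hB s (by simpa [dist_eq_norm] using hs), le_abs_self B]
  have h2 : x ^ (s - c).re ≤ x ^ (r + (1 - c)) := by
    refine Real.rpow_le_rpow_of_exponent_le hx ?_
    have := (abs_le.1 ((Complex.abs_re_le_norm (s - 1)).trans hs.le)).2
    simp only [Complex.sub_re, Complex.one_re, Complex.ofReal_re] at this ⊢
    linarith
  gcongr

/-! ### The main term of the divisor problem -/

/-- The main term `x p_{k-1}(log x)` of `D_k(x)`. -/
def mainTerm (k : ℕ) (x : ℝ) : ℂ := (x : ℂ) * mainPoly k x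

/-- The derivative of the main term, `Res_{s=1} ζ(s)^k x^{s-1}`. -/
def mainDeriv (k : ℕ) (x : ℝ) : ℂ := loop (1 / 8) fun s => riemannZeta s ^ k * (x : ℂ) ^ (s - 1)

/-- The second derivative of the main term. -/
def mainDeriv2 (k : ℕ) (x : ℝ) : ℂ :=
  loop (1 / 8) fun s => riemannZeta s ^ k * ((s - 1) * (x : ℂ) ^ (s - 1 - 1))

lemma mainTerm_eq_loop (k : ℕ) {x : ℝ} (hx : 0 < x) :
    mainTerm k x = loop (1 / 8) fun s => riemannZeta s ^ k / s * (x : ℂ) ^ (s - 0) := by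
  unfold mainTerm mainPoly
  have hx0 : (x : ℂ) ≠ 0 := by exact_mod_cast hx.ne'
  have : (fun s : ℂ => riemannZeta s ^ k * ((x : ℂ) ^ (s - 1) / s)) =
      fun s => riemannZeta s ^ k / s * (x : ℂ) ^ (s - 1) := by
    ext s; ring
  rw [this, residue_eq_loop ((puncturedHolo_zeta_pow_div k).mul (puncturedHolo_cpow hx 1)),
    const_mul_loop]
  congr 1
  ext s
  rw [Complex.cpow_sub _ _ hx0, Complex.cpow_one, sub_zero]
  field_simp

/-- Differentiating `x^s / s` in `x` cancels the denominator `s`. -/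
lemma hasDerivAt_mainTerm (k : ℕ) {x : ℝ} (hx : 0 < x) :
    HasDerivAt (mainTerm k) (mainDeriv k x) x := by
  have h := hasDerivAt_loop_cpow (r := 1 / 8) (by norm_num)
    ((puncturedHolo_zeta_pow_div k).continuousOn_sphere (by norm_num) le_rfl) 0 hx
  have h2 : mainDeriv k x =
      loop (1 / 8) fun s => riemannZeta s ^ k / s * ((s - 0) * (x : ℂ) ^ (s - 0 - 1)) := by
    refine loop_congr (by norm_num) fun s hs => ?_
    have := ne_zero_of_norm_sub_one_le hs.le
    rw [sub_zero]
    field_simp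
  rw [h2]
  refine h.congr_of_eventuallyEq ?_
  filter_upwards [lt_mem_nhds hx] with y hy
  exact mainTerm_eq_loop k hy

lemma hasDerivAt_mainDeriv (k : ℕ) {x : ℝ} (hx : 0 < x) :
    HasDerivAt (mainDeriv k) (mainDeriv2 k x) x :=
  hasDerivAt_loop_cpow (r := 1 / 8) (by norm_num)
    ((puncturedHolo_zeta_pow k).continuousOn_sphere (by norm_num) le_rfl) 1 hx

lemma mainDeriv2_eq (k : ℕ) : mainDeriv2 k = fun x : ℝ =>
    loop (1 / 8) fun s => riemannZeta s ^ k * (s - 1) * (x : ℂ) ^ (s - (2 : ℝ)) := by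
  ext x
  unfold mainDeriv2
  congr 1
  ext s
  rw [mul_assoc, sub_sub]
  norm_num

lemma puncturedHolo_zeta_pow_mul (k : ℕ) : PuncturedHolo fun s => riemannZeta s ^ k * (s - 1) :=
  (puncturedHolo_zeta_pow k).mul fun _ _ _ => differentiableAt_id.sub_const 1

lemma continuousAt_mainDeriv2 (k : ℕ) {x : ℝ} (hx : 0 < x) : ContinuousAt (mainDeriv2 k) x := by
  rw [mainDeriv2_eq]
  exact (hasDerivAt_loop_cpow (r := 1 / 8) (by norm_num)
    ((puncturedHolo_zeta_pow_mul k).continuousOn_sphere (by norm_num) le_rfl) _ hx).continuousAt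

lemma exists_norm_mainDeriv_le (k : ℕ) {r : ℝ} (h0 : 0 < r) (hr : r ≤ 1 / 8) :
    ∃ C : ℝ, 0 < C ∧ ∀ x : ℝ, 1 ≤ x → ‖mainDeriv k x‖ ≤ C * x ^ r := by
  obtain ⟨C, hC0, hC⟩ := exists_norm_loop_cpow_le (puncturedHolo_zeta_pow k) 1 h0 hr
  exact ⟨C, hC0, fun x hx => by simpa [mainDeriv] using hC x hx⟩

lemma exists_norm_mainDeriv2_le (k : ℕ) {r : ℝ} (h0 : 0 < r) (hr : r ≤ 1 / 8) :
    ∃ C : ℝ, 0 < C ∧ ∀ x : ℝ, 1 ≤ x → ‖mainDeriv2 k x‖ ≤ C * x ^ (r - 1) := by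
  obtain ⟨C, hC0, hC⟩ := exists_norm_loop_cpow_le (puncturedHolo_zeta_pow_mul k) 2 h0 hr
  refine ⟨C, hC0, fun x hx => ?_⟩
  have := hC x hx
  rw [mainDeriv2_eq]
  convert this using 3
  ring

/-! ### The local factors and the weights `Ψ` -/

/-- The Dirichlet series `∑_ν d_k(p^{ν+a}) p^{-νs}`. -/
def shiftedLocalSeries (k p a : ℕ) (s : ℂ) : ℂ :=
  ∑' ν : ℕ, (divFun k (p ^ (ν + a)) : ℂ) / (p : ℂ) ^ ((ν : ℂ) * s)

/-- For `Re s > 3/4` and `δ ≤ 1/4` the exponent `δν - ν Re s` is at most `-ν/2`. The geometric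
majorant is thus uniform in `p` and `s`, which gives both size and holomorphy of the local series.
-/
lemma exists_norm_localTerm_le (k : ℕ) {δ : ℝ} (h0 : 0 < δ) (hδ : δ ≤ 1 / 4) :
    ∃ C : ℝ, 0 < C ∧ ∀ p a ν : ℕ, p.Prime → ∀ s : ℂ, 3 / 4 < s.re →
      ‖(divFun k (p ^ (ν + a)) : ℂ) / (p : ℂ) ^ ((ν : ℂ) * s)‖ ≤
        C * ((p : ℝ) ^ δ) ^ a * ((2 : ℝ) ^ (-(1 / 2) : ℝ)) ^ ν := by
  obtain ⟨C, hC0, hC⟩ := exists_divFun_le k h0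
  refine ⟨C, hC0, fun p a ν hp s hs => ?_⟩
  have hp0 : (0 : ℝ) < p := by exact_mod_cast hp.pos
  have hp2 : (2 : ℝ) ≤ p := by exact_mod_cast hp.two_le
  rw [norm_div, Complex.norm_natCast, Complex.norm_natCast_cpow_of_pos hp.pos]
  have hre : ((ν : ℂ) * s).re = ν * s.re := by simp
  rw [hre, div_eq_mul_inv, ← Real.rpow_neg hp0.le]
  have h1 := hC (p ^ (ν + a)) (pow_ne_zero _ hp.ne_zero)
  have h2 : (((p ^ (ν + a) : ℕ) : ℝ)) ^ δ = ((p : ℝ) ^ δ) ^ a * (p : ℝ) ^ (δ * ν) := by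
    rw [Nat.cast_pow, pow_add, Real.mul_rpow (by positivity) (by positivity), mul_comm,
      ← Real.rpow_natCast, ← Real.rpow_natCast, ← Real.rpow_natCast, ← Real.rpow_mul hp0.le,
      ← Real.rpow_mul hp0.le, ← Real.rpow_mul hp0.le, mul_comm (a : ℝ), mul_comm (ν : ℝ)]
  rw [h2] at h1
  calc (divFun k (p ^ (ν + a)) : ℝ) * (p : ℝ) ^ (-(ν * s.re))
      ≤ (C * (((p : ℝ) ^ δ) ^ a * (p : ℝ) ^ (δ * ν))) * (p : ℝ) ^ (-(ν * s.re)) := by gcongr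
    _ = C * ((p : ℝ) ^ δ) ^ a * ((p : ℝ) ^ (δ * ν) * (p : ℝ) ^ (-(ν * s.re))) := by ring
    _ ≤ C * ((p : ℝ) ^ δ) ^ a * ((2 : ℝ) ^ (-(1 / 2) : ℝ)) ^ ν := by
      gcongr
      rw [← Real.rpow_add hp0, ← Real.rpow_natCast, ← Real.rpow_mul (by norm_num)]
      have hν : (0 : ℝ) ≤ ν := Nat.cast_nonneg ν
      calc (p : ℝ) ^ (δ * ν + -(ν * s.re)) ≤ (p : ℝ) ^ (-(1 / 2) * (ν : ℝ)) := by
            refine Real.rpow_le_rpow_of_exponent_le (by linarith) ?_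
            nlinarith
        _ ≤ (2 : ℝ) ^ (-(1 / 2) * (ν : ℝ)) :=
            Real.rpow_le_rpow_of_nonpos (by norm_num) hp2 (by linarith)

lemma two_rpow_neg_half_lt_one : (2 : ℝ) ^ (-(1 / 2) : ℝ) < 1 :=
  Real.rpow_lt_one_of_one_lt_of_neg one_lt_two (by norm_num)

lemma summable_geometric_two_rpow : Summable fun ν : ℕ => ((2 : ℝ) ^ (-(1 / 2) : ℝ)) ^ ν :=
  summable_geometric_of_lt_one (by positivity) two_rpow_neg_half_lt_one

lemma exists_norm_shiftedLocalSeries_le (k : ℕ) {δ : ℝ} (h0 : 0 < δ) (hδ : δ ≤ 1 / 4) :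
    ∃ C : ℝ, 0 < C ∧ ∀ p a : ℕ, p.Prime → ∀ s : ℂ, 3 / 4 < s.re →
      ‖shiftedLocalSeries k p a s‖ ≤ C * ((p : ℝ) ^ δ) ^ a := by
  obtain ⟨C, hC0, hC⟩ := exists_norm_localTerm_le k h0 hδ
  refine ⟨C * (1 - (2 : ℝ) ^ (-(1 / 2) : ℝ))⁻¹, mul_pos hC0 (inv_pos.2 (sub_pos.2
    two_rpow_neg_half_lt_one)), fun p a hp s hs => ?_⟩
  have := tsum_of_norm_bounded (((hasSum_geometric_of_lt_one (by positivity)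
    two_rpow_neg_half_lt_one).mul_left (C * ((p : ℝ) ^ δ) ^ a))) fun ν => hC p a ν hp s hs
  calc _ ≤ _ := this
    _ = _ := by ring

lemma differentiableAt_shiftedLocalSeries (k a : ℕ) {p : ℕ} (hp : p.Prime) {s : ℂ}
    (hs : 3 / 4 < s.re) : DifferentiableAt ℂ (shiftedLocalSeries k p a) s := by
  obtain ⟨C, hC0, hC⟩ := exists_norm_localTerm_le k (δ := 1 / 4) (by norm_num) le_rfl
  have hU : IsOpen {s : ℂ | 3 / 4 < s.re} := isOpen_lt continuous_const Complex.continuous_re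
  have hp0 : (p : ℂ) ≠ 0 := by exact_mod_cast hp.ne_zero
  refine (Complex.differentiableOn_tsum_of_summable_norm
    (summable_geometric_two_rpow.mul_left (C * ((p : ℝ) ^ (1 / 4 : ℝ)) ^ a)) (fun ν => ?_) hU
    (fun ν s hs => hC p a ν hp s hs)).differentiableAt (hU.mem_nhds hs)
  refine DifferentiableOn.div (differentiableOn_const _) ?_ fun s _ => by
    simp [Complex.cpow_eq_zero_iff, hp0]
  exact ((differentiable_id.const_mul _).const_cpow (Or.inl hp0)).differentiableOn

lemma Psi_eq (d e : ℕ) (s : ℂ) (q k : ℕ) : Psi d e s q k =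
    ((d : ℂ) * (ArithmeticFunction.moebius d : ℂ) * (ArithmeticFunction.moebius e : ℂ)
      / ((Nat.totient d : ℂ) * (e : ℂ))) *
    ∏ p ∈ (e * q / d).primeFactors, ((1 - 1 / (p : ℂ) ^ s) ^ k *
      shiftedLocalSeries k p (padicValNat p (e * q / d)) s) := rfl

lemma differentiableAt_Psi (d e q k : ℕ) {s : ℂ} (hs : 3 / 4 < s.re) :
    DifferentiableAt ℂ (fun s => Psi d e s q k) s := by
  simp only [Psi_eq]
  refine DifferentiableAt.const_mul ?_ _
  refine DifferentiableAt.fun_finsetProd fun p hp => ?_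
  have hp := Nat.prime_of_mem_primeFactors hp
  have hp0 : (p : ℂ) ≠ 0 := by exact_mod_cast hp.ne_zero
  refine DifferentiableAt.mul (DifferentiableAt.pow (DifferentiableAt.sub
    (differentiableAt_const _) (DifferentiableAt.div (differentiableAt_const _)
      (differentiableAt_id.const_cpow (Or.inl hp0)) (by simp [Complex.cpow_eq_zero_iff, hp0]))) k)
    (differentiableAt_shiftedLocalSeries k _ hp hs)

lemma norm_one_sub_cpow_le {p : ℕ} (hp : p.Prime) {s : ℂ} (hs : 3 / 4 < s.re) (k : ℕ) :
    ‖(1 - 1 / (p : ℂ) ^ s) ^ k‖ ≤ 2 ^ k := by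
  rw [norm_pow]
  gcongr
  refine (norm_sub_le _ _).trans ?_
  rw [norm_one, norm_div, norm_one, Complex.norm_natCast_cpow_of_pos hp.pos]
  have : (1 : ℝ) ≤ (p : ℝ) ^ s.re :=
    Real.one_le_rpow (by exact_mod_cast hp.one_le) (by linarith)
  have := div_le_one_of_le₀ this (by positivity)
  linarith

lemma exists_norm_prod_localFactor_le (k : ℕ) {δ : ℝ} (h0 : 0 < δ) :
    ∃ C : ℝ, 0 < C ∧ ∀ m : ℕ, m ≠ 0 → ∀ s : ℂ, 3 / 4 < s.re →
      ‖∏ p ∈ m.primeFactors, ((1 - 1 / (p : ℂ) ^ s) ^ k *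
        shiftedLocalSeries k p (padicValNat p m) s)‖ ≤ C * (m : ℝ) ^ δ := by
  -- One `η` pays for the constant `2^k A` lost at each prime factor, the other for `∏ p^(η ν_p(m))
  -- = m^η`.
  set η := min (δ / 2) (1 / 4) with hη
  have hη0 : 0 < η := lt_min (by linarith) (by norm_num)
  obtain ⟨A, hA0, hA⟩ := exists_norm_shiftedLocalSeries_le k hη0 (min_le_right _ _)
  obtain ⟨C, hC0, hC⟩ := exists_pow_card_primeFactors_le (2 ^ k * A) (by positivity) hη0
  refine ⟨C, hC0, fun m hm s hs => ?_⟩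
  have hm1 : (1 : ℝ) ≤ m := by exact_mod_cast Nat.one_le_iff_ne_zero.2 hm
  rw [norm_prod]
  calc _ ≤ ∏ p ∈ m.primeFactors, ((2 ^ k * A) * ((p : ℝ) ^ η) ^ (m.factorization p)) := by
        refine Finset.prod_le_prod (fun _ _ => norm_nonneg _) fun p hp => ?_
        have hp := Nat.prime_of_mem_primeFactors hp
        rw [norm_mul, Nat.factorization_def _ hp, mul_assoc]
        exact mul_le_mul (norm_one_sub_cpow_le hp hs k) (hA p _ hp s hs) (norm_nonneg _)
          (by positivity)
    _ = (2 ^ k * A) ^ m.primeFactors.card * (m : ℝ) ^ η := by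
        rw [Finset.prod_mul_distrib, Finset.prod_const, prod_primeFactors_rpow_pow hm]
    _ ≤ (C * (m : ℝ) ^ η) * (m : ℝ) ^ η := by gcongr; exact hC m hm
    _ = C * (m : ℝ) ^ (η + η) := by rw [Real.rpow_add (by linarith)]; ring
    _ ≤ C * (m : ℝ) ^ δ := by
        gcongr
        linarith [min_le_left (δ / 2) (1 / 4)]

lemma norm_moebius_le_one (n : ℕ) : ‖(ArithmeticFunction.moebius n : ℂ)‖ ≤ 1 := by
  rw [Complex.norm_intCast]
  exact_mod_cast ArithmeticFunction.abs_moebius_le_one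

theorem exists_norm_Psi_le (k : ℕ) {δ : ℝ} (h0 : 0 < δ) :
    ∃ C : ℝ, 0 < C ∧ ∀ q d e : ℕ, q ≠ 0 → d ∣ q → e ∣ d → ∀ s : ℂ, 3 / 4 < s.re →
      ‖Psi d e s q k‖ ≤ C * (q : ℝ) ^ δ := by
  obtain ⟨A, hA0, hA⟩ := exists_norm_prod_localFactor_le k (half_pos h0)
  obtain ⟨C, hC0, hC⟩ := exists_card_divisors_le (half_pos h0)
  refine ⟨C * A, by positivity, fun q d e hq hd he s hs => ?_⟩
  have hd0 : d ≠ 0 := ne_zero_of_dvd_ne_zero hq hd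
  have he0 : e ≠ 0 := ne_zero_of_dvd_ne_zero hd0 he
  have hq1 : (0 : ℝ) < q := by exact_mod_cast Nat.pos_of_ne_zero hq
  have hm0 : e * q / d ≠ 0 := by
    obtain ⟨c, rfl⟩ := hd
    rw [mul_left_comm, Nat.mul_div_cancel_left _ (Nat.pos_of_ne_zero hd0)]
    exact mul_ne_zero he0 (right_ne_zero_of_mul hq)
  have hmq : e * q / d ≤ q := by
    refine Nat.div_le_of_le_mul ?_
    gcongr
    exact Nat.le_of_dvd (Nat.pos_of_ne_zero hd0) he
  have hdq : d ≤ q := Nat.le_of_dvd (Nat.pos_of_ne_zero hq) hd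
  rw [Psi_eq, norm_mul]
  have h1 : ‖((d : ℂ) * (ArithmeticFunction.moebius d : ℂ) * (ArithmeticFunction.moebius e : ℂ)
      / ((Nat.totient d : ℂ) * (e : ℂ)))‖ ≤ C * (q : ℝ) ^ (δ / 2) := by
    rw [norm_div, norm_mul, norm_mul, norm_mul, Complex.norm_natCast, Complex.norm_natCast,
      Complex.norm_natCast]
    have hφ : (0 : ℝ) < d.totient := by
      exact_mod_cast Nat.totient_pos.2 (Nat.pos_of_ne_zero hd0)
    have he1 : (1 : ℝ) ≤ e := by exact_mod_cast Nat.one_le_iff_ne_zero.2 he0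
    calc _ ≤ (d : ℝ) * 1 * 1 / ((d.totient : ℝ) * 1) := by
          gcongr <;> exact norm_moebius_le_one _
      _ = (d : ℝ) / d.totient := by ring
      _ ≤ d.divisors.card := cast_div_totient_le hd0
      _ ≤ C * (d : ℝ) ^ (δ / 2) := hC d hd0
      _ ≤ _ := by gcongr
  calc _ ≤ (C * (q : ℝ) ^ (δ / 2)) * (A * ((e * q / d : ℕ) : ℝ) ^ (δ / 2)) :=
        mul_le_mul h1 (hA _ hm0 s hs) (norm_nonneg _) (by positivity)
    _ ≤ (C * (q : ℝ) ^ (δ / 2)) * (A * (q : ℝ) ^ (δ / 2)) := by gcongr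
    _ = C * A * (q : ℝ) ^ (δ / 2 + δ / 2) := by rw [Real.rpow_add hq1]; ring
    _ = _ := by rw [add_halves]

/-! ### The functions `Q_k(x, q)` -/

/-- The factor of the integrand of `Q_k(x,q)` not depending on `x`, without `ζ(s)^k`. -/
def weight (k q : ℕ) (s : ℂ) : ℂ :=
  ∑ d ∈ q.divisors, ∑ e ∈ d.divisors,
    Psi d e s q k * ((((e : ℝ) / ((d : ℝ) * (q : ℝ)) : ℝ) : ℂ) ^ (s - 1))

lemma puncturedHolo_weight (k q : ℕ) : PuncturedHolo (weight k q) := by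
  intro s _ hs
  refine DifferentiableAt.fun_sum fun d hd => DifferentiableAt.fun_sum fun e he => ?_
  have hd0 : d ≠ 0 := (Nat.pos_of_mem_divisors hd).ne'
  have he0 : e ≠ 0 := (Nat.pos_of_mem_divisors he).ne'
  have hq0 : q ≠ 0 := (Nat.mem_divisors.1 hd).2
  refine (differentiableAt_Psi d e q k (by linarith [seven_eighths_le_re hs])).mul
    ((differentiableAt_id.sub_const 1).const_cpow (Or.inl ?_))
  rw [Complex.ofReal_ne_zero]
  positivity

lemma puncturedHolo_zeta_pow_mul_weight (k q : ℕ) :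
    PuncturedHolo fun s => riemannZeta s ^ k * weight k q s :=
  (puncturedHolo_zeta_pow k).mul (puncturedHolo_weight k q)

lemma Q_eq_loop (k q : ℕ) {x : ℝ} (hx : 0 < x) :
    Q k x q = loop (1 / 8) fun s => riemannZeta s ^ k * weight k q s * (x : ℂ) ^ (s - 1) := by
  unfold Q loop
  congr 2
  ext s
  simp only [mul_assoc (riemannZeta s ^ k)]
  congr 1
  unfold weight
  simp only [Finset.sum_mul]
  refine Finset.sum_congr rfl fun d _ => Finset.sum_congr rfl fun e _ => ?_
  rw [mul_div_right_comm, Complex.ofReal_mul,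
    Complex.mul_cpow_ofReal_nonneg (by positivity) hx.le, mul_assoc]

lemma weight_one (k : ℕ) (s : ℂ) : weight k 1 s = 1 := by
  simp [weight, Psi]

/-- The link between the two sides: the leading term of the singular series is the squared density
of `d_k`. -/
lemma Q_one (k : ℕ) {x : ℝ} (hx : 0 < x) : Q k x 1 = mainDeriv k x := by
  rw [Q_eq_loop k 1 hx]
  simp [weight_one, mainDeriv]

lemma continuousAt_Q (k q : ℕ) {x : ℝ} (hx : 0 < x) : ContinuousAt (fun x => Q k x q) x := by
  have h := (hasDerivAt_loop_cpow (r := 1 / 8) (by norm_num)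
    ((puncturedHolo_zeta_pow_mul_weight k q).continuousOn_sphere (by norm_num) le_rfl)
    1 hx).continuousAt
  refine h.congr ?_
  filter_upwards [lt_mem_nhds hx] with y hy
  exact (Q_eq_loop k q hy).symm

/-- The exponent `4r` splits as `r` for the number of pairs `(d, e)`, `r` for `Psi`, and `2r` for
the power of `e/(dq)`, which lies between `q^(-2)` and `1`. -/
lemma exists_norm_weight_le (k : ℕ) {r : ℝ} (h0 : 0 < r) (hr : r ≤ 1 / 8) :
    ∃ C : ℝ, 0 < C ∧ ∀ q : ℕ, q ≠ 0 → ∀ s : ℂ, ‖s - 1‖ = r →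
      ‖weight k q s‖ ≤ C * (q : ℝ) ^ (4 * r) := by
  obtain ⟨A, hA0, hA⟩ := exists_norm_Psi_le k h0
  obtain ⟨B, hB0, hB⟩ := exists_card_divisors_pow_le 2 h0
  refine ⟨B * A, by positivity, fun q hq s hs => ?_⟩
  have hq1 : (1 : ℝ) ≤ q := by exact_mod_cast Nat.one_le_iff_ne_zero.2 hq
  have hs34 : 3 / 4 < s.re := by linarith [seven_eighths_le_re (hs.le.trans hr)]
  have hsre := (abs_le.1 ((Complex.abs_re_le_norm (s - 1)).trans hs.le)).1
  have term : ∀ d ∈ q.divisors, ∀ e ∈ d.divisors,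
      ‖Psi d e s q k * ((((e : ℝ) / ((d : ℝ) * (q : ℝ)) : ℝ) : ℂ) ^ (s - 1))‖ ≤
        A * (q : ℝ) ^ (3 * r) := by
    intro d hd e he
    have hd1 : (1 : ℝ) ≤ d := by exact_mod_cast Nat.pos_of_mem_divisors hd
    have he1 : (1 : ℝ) ≤ e := by exact_mod_cast Nat.pos_of_mem_divisors he
    have hdq : (d : ℝ) ≤ q := by exact_mod_cast Nat.divisor_le hd
    have hed : (e : ℝ) ≤ d := by exact_mod_cast Nat.divisor_le he
    have ht0 : 0 < (e : ℝ) / (d * q) := by positivity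
    have ht1 : (e : ℝ) / (d * q) ≤ 1 := by
      rw [div_le_one (by positivity)]
      nlinarith
    have htq : 1 / (q : ℝ) ^ (2 : ℝ) ≤ (e : ℝ) / (d * q) := by
      rw [Real.rpow_two]
      apply div_le_div₀ (by positivity) he1 (by positivity)
      nlinarith
    rw [norm_mul, Complex.norm_cpow_eq_rpow_re_of_pos ht0]
    have h1 : ((e : ℝ) / (d * q)) ^ (s - 1).re ≤ (q : ℝ) ^ (2 * r) := by
      calc _ ≤ ((e : ℝ) / (d * q)) ^ (-r) := Real.rpow_le_rpow_of_exponent_ge ht0 ht1 hsre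
        _ ≤ (1 / (q : ℝ) ^ (2 : ℝ)) ^ (-r) :=
          Real.rpow_le_rpow_of_nonpos (by positivity) htq (by linarith)
        _ = _ := by
          rw [one_div, ← Real.rpow_neg (by positivity), ← Real.rpow_mul (by positivity)]
          congr 1; ring
    calc _ ≤ (A * (q : ℝ) ^ r) * (q : ℝ) ^ (2 * r) :=
          mul_le_mul (hA q d e hq (Nat.dvd_of_mem_divisors hd) (Nat.dvd_of_mem_divisors he) s hs34)
            h1 (by positivity) (by positivity)
      _ = A * (q : ℝ) ^ (r + 2 * r) := by rw [Real.rpow_add (by positivity)]; ring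
      _ = _ := by congr 2; ring
  calc ‖weight k q s‖ ≤ ∑ d ∈ q.divisors, ∑ _e ∈ q.divisors, A * (q : ℝ) ^ (3 * r) := by
        refine (norm_sum_le _ _).trans (Finset.sum_le_sum fun d hd => ?_)
        refine (norm_sum_le _ _).trans ((Finset.sum_le_sum (term d hd)).trans ?_)
        refine Finset.sum_le_sum_of_subset_of_nonneg
          (Nat.divisors_subset_of_dvd hq (Nat.dvd_of_mem_divisors hd)) fun _ _ _ => by positivity
    _ = (q.divisors.card : ℝ) ^ 2 * (A * (q : ℝ) ^ (3 * r)) := by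
        simp only [Finset.sum_const, nsmul_eq_mul]; ring
    _ ≤ (B * (q : ℝ) ^ r) * (A * (q : ℝ) ^ (3 * r)) := by gcongr; exact hB q hq
    _ = B * A * (q : ℝ) ^ (r + 3 * r) := by rw [Real.rpow_add (by positivity)]; ring
    _ = _ := by congr 2; ring

theorem exists_norm_Q_le (k : ℕ) {δ : ℝ} (h0 : 0 < δ) (hδ : δ ≤ 1 / 8) :
    ∃ C : ℝ, 0 < C ∧ ∀ q : ℕ, q ≠ 0 → ∀ x : ℝ, 1 ≤ x →
      ‖Q k x q‖ ≤ C * x ^ δ * (q : ℝ) ^ δ := by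
  set r := δ / 4
  have hr0 : 0 < r := by positivity
  have hr : r ≤ 1 / 8 := by simp only [r]; linarith
  obtain ⟨A, hA0, hA⟩ := exists_norm_weight_le k hr0 hr
  obtain ⟨B, hB⟩ := (isCompact_sphere (1 : ℂ) r).exists_bound_of_continuousOn
    ((puncturedHolo_zeta_pow k).continuousOn_sphere hr0 hr)
  refine ⟨r * ((|B| + 1) * A), by positivity, fun q hq x hx => ?_⟩
  have hx0 : 0 < x := by linarith
  rw [Q_eq_loop k q hx0, ← loop_eq_of_puncturedHolo ((puncturedHolo_zeta_pow_mul_weight k q).mul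
    (puncturedHolo_cpow hx0 1)) hr0 hr]
  have : ∀ s : ℂ, ‖s - 1‖ = r →
      ‖riemannZeta s ^ k * weight k q s * (x : ℂ) ^ (s - 1)‖ ≤
        (|B| + 1) * (A * (q : ℝ) ^ δ) * x ^ δ := by
    intro s hs
    rw [norm_mul, norm_mul, Complex.norm_cpow_eq_rpow_re_of_pos hx0]
    have h1 : ‖riemannZeta s ^ k‖ ≤ |B| + 1 := by
      linarith [hB s (by simpa [dist_eq_norm] using hs), le_abs_self B]
    have h2 : x ^ (s - 1).re ≤ x ^ δ := by
      refine Real.rpow_le_rpow_of_exponent_le hx ?_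
      have := (abs_le.1 ((Complex.abs_re_le_norm (s - 1)).trans hs.le)).2
      simp only [r] at this
      linarith
    have h3 := hA q hq s hs
    rw [show 4 * r = δ by simp only [r]; ring] at h3
    gcongr
  refine (norm_loop_le hr0.le this).trans (le_of_eq ?_)
  ring

/-! ### Ramanujan sums on average -/

lemma divisors_gcd_eq {q h : ℕ} (hq : q ≠ 0) :
    (Nat.gcd h q).divisors = q.divisors.filter (· ∣ h) := by
  ext d
  simp [Nat.mem_divisors, Nat.dvd_gcd_iff, hq, and_comm]

lemma sum_ramanujanSum {q : ℕ} (hq : q ≠ 0) (L : ℕ) :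
    ∑ h ∈ Finset.Icc 1 L, ramanujanSum q h =
      ∑ d ∈ q.divisors, ((d * (L / d) : ℕ) : ℤ) * ArithmeticFunction.moebius (q / d) := by
  unfold ramanujanSum
  simp only [divisors_gcd_eq hq, Finset.sum_filter]
  rw [Finset.sum_comm]
  refine Finset.sum_congr rfl fun d _ => ?_
  rw [← Finset.sum_filter, Finset.sum_const, nsmul_eq_mul]
  have : (Finset.Icc 1 L).filter (d ∣ ·) = (Finset.Ioc 0 L).filter (d ∣ ·) := by
    congr 1
  rw [this, Nat.Ioc_filter_dvd_card_eq_div]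
  push_cast
  ring

lemma sum_divisors_moebius_div {q : ℕ} (hq : 2 ≤ q) :
    ∑ d ∈ q.divisors, ArithmeticFunction.moebius (q / d) = 0 := by
  rw [Nat.sum_div_divisors q fun d => ArithmeticFunction.moebius d,
    ← ArithmeticFunction.coe_mul_zeta_apply, ArithmeticFunction.moebius_mul_coe_zeta,
    ArithmeticFunction.one_apply_ne (by omega)]

lemma abs_moebius_le (n : ℕ) : |ArithmeticFunction.moebius n| ≤ 1 :=
  ArithmeticFunction.abs_moebius_le_one

lemma abs_sum_ramanujanSum_le {q : ℕ} (hq : q ≠ 0) (L : ℕ) :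
    |∑ h ∈ Finset.Icc 1 L, ramanujanSum q h| ≤ q.divisors.card * L := by
  rw [sum_ramanujanSum hq, ← nsmul_eq_mul]
  refine (Finset.abs_sum_le_sum_abs _ _).trans (Finset.sum_le_card_nsmul _ _ _ fun d _ => ?_)
  rw [abs_mul, Nat.abs_cast]
  calc ((d * (L / d) : ℕ) : ℤ) * |ArithmeticFunction.moebius (q / d)| ≤ (L : ℤ) * 1 :=
        mul_le_mul (by exact_mod_cast Nat.mul_div_le L d) (abs_moebius_le _) (abs_nonneg _)
          (by positivity)
    _ = L := mul_one _

/-- In `d ⌊L/d⌋ = L - (L mod d)` the part `L` disappears because `∑ μ(q/d) = 0` for `q ≥ 2`; the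
remainders are smaller than `d ≤ q`. -/
lemma abs_sum_ramanujanSum_le' {q : ℕ} (hq : 2 ≤ q) (L : ℕ) :
    |∑ h ∈ Finset.Icc 1 L, ramanujanSum q h| ≤ q.divisors.card * q := by
  have h1 : ∑ h ∈ Finset.Icc 1 L, ramanujanSum q h =
      ∑ d ∈ q.divisors, -(((L % d : ℕ) : ℤ) * ArithmeticFunction.moebius (q / d)) := by
    rw [sum_ramanujanSum (by omega)]
    have : ∀ d : ℕ, ((d * (L / d) : ℕ) : ℤ) * ArithmeticFunction.moebius (q / d) =
        L * ArithmeticFunction.moebius (q / d) +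
          -(((L % d : ℕ) : ℤ) * ArithmeticFunction.moebius (q / d)) := by
      intro d
      have h : ((d * (L / d) : ℕ) : ℤ) = L - ((L % d : ℕ) : ℤ) := by
        rw [eq_sub_iff_add_eq]
        exact_mod_cast Nat.div_add_mod L d
      rw [h]; ring
    simp only [this]
    rw [Finset.sum_add_distrib, ← Finset.mul_sum, sum_divisors_moebius_div hq]
    simp
  rw [h1, ← nsmul_eq_mul]
  refine (Finset.abs_sum_le_sum_abs _ _).trans (Finset.sum_le_card_nsmul _ _ _ fun d hd => ?_)
  rw [abs_neg, abs_mul, Nat.abs_cast]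
  have h2 : L % d ≤ q :=
    (Nat.mod_lt _ (Nat.pos_of_mem_divisors hd)).le.trans (Nat.divisor_le hd)
  calc ((L % d : ℕ) : ℤ) * |ArithmeticFunction.moebius (q / d)| ≤ (q : ℤ) * 1 :=
        mul_le_mul (by exact_mod_cast h2) (abs_moebius_le _) (abs_nonneg _) (by positivity)
    _ = q := mul_one _

/-- The two bounds combine to `τ(q) min(q, L)`, and `min(q, L) ≤ q^(1-η) L^η`. The saving `q^(-η)`
makes the later sum over `q` converge. -/
lemma norm_sum_ramanujanSum_le {q : ℕ} (hq : 2 ≤ q) (L : ℕ) {η : ℝ} (h0 : 0 ≤ η) (h1 : η ≤ 1) :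
    ‖∑ h ∈ Finset.Icc 1 L, (ramanujanSum q h : ℂ)‖ ≤
      q.divisors.card * ((q : ℝ) ^ (1 - η) * (L : ℝ) ^ η) := by
  have hcast : ‖∑ h ∈ Finset.Icc 1 L, (ramanujanSum q h : ℂ)‖ =
      ((|∑ h ∈ Finset.Icc 1 L, ramanujanSum q h| : ℤ) : ℝ) := by
    rw [← Int.cast_sum, Complex.norm_intCast, Int.cast_abs]
  rw [hcast]
  have hq0 : (0 : ℝ) < q := by exact_mod_cast (by omega : 0 < q)
  rcases le_total L q with h | h
  · calc ((|∑ h ∈ Finset.Icc 1 L, ramanujanSum q h| : ℤ) : ℝ) ≤ q.divisors.card * (L : ℝ) := by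
          exact_mod_cast abs_sum_ramanujanSum_le (by omega) L
      _ ≤ _ := by
        gcongr
        rcases Nat.eq_zero_or_pos L with rfl | hL
        · simp only [Nat.cast_zero]; positivity
        have hL0 : (0 : ℝ) < L := by exact_mod_cast hL
        calc (L : ℝ) = (L : ℝ) ^ (1 - η) * (L : ℝ) ^ η := by
              rw [← Real.rpow_add hL0, sub_add_cancel, Real.rpow_one]
          _ ≤ _ := by
            gcongr
  · calc ((|∑ h ∈ Finset.Icc 1 L, ramanujanSum q h| : ℤ) : ℝ) ≤ q.divisors.card * (q : ℝ) := by
          exact_mod_cast abs_sum_ramanujanSum_le' hq L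
      _ ≤ _ := by
        gcongr
        calc (q : ℝ) = (q : ℝ) ^ (1 - η) * (q : ℝ) ^ η := by
              rw [← Real.rpow_add hq0, sub_add_cancel, Real.rpow_one]
          _ ≤ _ := by gcongr

/-- A crude bound, uniform in `q`; it serves only for the convergence and continuity of the singular
series at fixed `h`. -/
lemma norm_ramanujanSum_le (q : ℕ) {h : ℕ} (hh : h ≠ 0) : ‖(ramanujanSum q h : ℂ)‖ ≤ h * h := by
  have hg : Nat.gcd h q ≤ h := Nat.gcd_le_left q (Nat.pos_of_ne_zero hh)
  have : |ramanujanSum q h| ≤ (h * h : ℕ) := by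
    unfold ramanujanSum
    refine (Finset.abs_sum_le_sum_abs _ _).trans ((Finset.sum_le_card_nsmul _ _ (h : ℤ)
      fun d hd => ?_).trans ?_)
    · rw [abs_mul, Nat.abs_cast]
      calc (d : ℤ) * |ArithmeticFunction.moebius (q / d)| ≤ (h : ℤ) * 1 :=
            mul_le_mul (by exact_mod_cast (Nat.divisor_le hd).trans hg) (abs_moebius_le _)
              (abs_nonneg _) (by positivity)
        _ = h := mul_one _
    · rw [nsmul_eq_mul]
      push_cast
      gcongr
      exact_mod_cast (Nat.card_divisors_le_self _).trans hg
  rw [Complex.norm_intCast]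
  exact_mod_cast this

/-! ### The singular series -/

lemma summable_pnat_rpow {s : ℝ} (hs : s < -1) : Summable fun q : ℕ+ => ((q : ℕ) : ℝ) ^ s :=
  (Real.summable_nat_rpow.2 hs).comp_injective PNat.coe_injective

/-- The `q`-th term of the singular series. -/
def singTerm (k : ℕ) (x : ℝ) (h : ℕ) (q : ℕ+) : ℂ :=
  (ramanujanSum (q : ℕ) h : ℂ) / ((q : ℕ) : ℂ) ^ 2 * Q k x (q : ℕ) ^ 2

lemma exists_norm_singTerm_le (k : ℕ) : ∃ C : ℝ, 0 < C ∧ ∀ (h : ℕ) (q : ℕ+) (x : ℝ),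
    h ≠ 0 → 1 ≤ x → ‖singTerm k x h q‖ ≤ h * h * C * x * ((q : ℕ) : ℝ) ^ (-(7 / 4) : ℝ) := by
  obtain ⟨C, hC0, hC⟩ := exists_norm_Q_le k (δ := 1 / 8) (by norm_num) le_rfl
  refine ⟨C ^ 2, by positivity, fun h q x hh hx => ?_⟩
  have hq0 : (0 : ℝ) < ((q : ℕ) : ℝ) := by exact_mod_cast q.pos
  unfold singTerm
  rw [norm_mul, norm_div, norm_pow, norm_pow, Complex.norm_natCast]
  have h1 := hC q q.pos.ne' x hx
  have h2 := norm_ramanujanSum_le (q : ℕ) hh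
  have h3 : x ^ (1 / 8 : ℝ) * x ^ (1 / 8 : ℝ) ≤ x := by
    rw [← Real.rpow_add (by linarith)]
    calc _ ≤ x ^ (1 : ℝ) := Real.rpow_le_rpow_of_exponent_le hx (by norm_num)
      _ = x := Real.rpow_one x
  calc _ ≤ (h * h : ℝ) / ((q : ℕ) : ℝ) ^ 2 *
          (C * x ^ (1 / 8 : ℝ) * ((q : ℕ) : ℝ) ^ (1 / 8 : ℝ)) ^ 2 := by
        gcongr
    _ = h * h * C ^ 2 * (x ^ (1 / 8 : ℝ) * x ^ (1 / 8 : ℝ)) *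
          (((q : ℕ) : ℝ) ^ (1 / 8 : ℝ) * ((q : ℕ) : ℝ) ^ (1 / 8 : ℝ) *
            (((q : ℕ) : ℝ) ^ (2 : ℝ))⁻¹) := by rw [Real.rpow_two]; ring
    _ ≤ h * h * C ^ 2 * x * (((q : ℕ) : ℝ) ^ (1 / 8 : ℝ) * ((q : ℕ) : ℝ) ^ (1 / 8 : ℝ) *
            (((q : ℕ) : ℝ) ^ (2 : ℝ))⁻¹) := by gcongr
    _ = _ := by
      rw [← Real.rpow_neg hq0.le, ← Real.rpow_add hq0, ← Real.rpow_add hq0]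
      norm_num

lemma summable_singTerm (k : ℕ) {h : ℕ} (hh : h ≠ 0) {x : ℝ} (hx : 1 ≤ x) :
    Summable (singTerm k x h) := by
  obtain ⟨C, hC0, hC⟩ := exists_norm_singTerm_le k
  exact Summable.of_norm_bounded ((summable_pnat_rpow (s := -(7 / 4)) (by norm_num)).mul_left
    (h * h * C * x)) fun q => hC h q x hh hx

lemma continuousOn_singSeries (k : ℕ) {h : ℕ} (hh : h ≠ 0) (N : ℝ) :
    ContinuousOn (fun x => singSeries k x h) (Set.Icc 1 N) := by
  obtain ⟨C, hC0, hC⟩ := exists_norm_singTerm_le k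
  refine continuousOn_tsum (u := fun q : ℕ+ => h * h * C * N * ((q : ℕ) : ℝ) ^ (-(7 / 4) : ℝ))
    (fun q x hx => ?_) ((summable_pnat_rpow (by norm_num)).mul_left _) fun q x hx => ?_
  · have : 0 < x := by linarith [hx.1]
    exact (continuousAt_const.mul ((continuousAt_Q k q this).pow 2)).continuousWithinAt
  · refine (hC h q x hh hx.1).trans ?_
    have := hx.2
    gcongr

theorem exists_norm_sum_singSeries_sub_le (k : ℕ) {δ : ℝ} (h0 : 0 < δ) (hδ : δ ≤ 1 / 2) :
    ∃ C : ℝ, 0 < C ∧ ∀ (L : ℕ) (x : ℝ), 1 ≤ x →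
      ‖(∑ h ∈ Finset.Icc 1 L, singSeries k x h) - L * mainDeriv k x ^ 2‖ ≤
        C * x ^ δ * (L : ℝ) ^ δ := by
  -- The powers of `q` add up to `r + (1 - 4r) - 2 + 2r = -1 - r`, from `τ(q)`, the Ramanujan
  -- average, `q⁻²` and `Q²`; this is summable.
  set r := δ / 4 with hr
  have hr0 : 0 < r := by positivity
  obtain ⟨A, hA0, hA⟩ := exists_norm_Q_le k hr0 (by linarith)
  obtain ⟨B, hB0, hB⟩ := exists_card_divisors_le hr0
  have hsum : Summable fun q : ℕ+ => ((q : ℕ) : ℝ) ^ (-1 - r) := summable_pnat_rpow (by linarith)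
  set Z := ∑' q : ℕ+, ((q : ℕ) : ℝ) ^ (-1 - r)
  have hZ0 : 0 ≤ Z := tsum_nonneg fun q => by positivity
  refine ⟨B * A ^ 2 * (Z + 1), by positivity, fun L x hx => ?_⟩
  have hx0 : 0 < x := by linarith
  set f : ℕ+ → ℂ := fun q => ∑ h ∈ Finset.Icc 1 L, singTerm k x h q with hf
  have hsingle : ∀ h ∈ Finset.Icc 1 L, Summable (singTerm k x h) := fun h hh =>
    summable_singTerm k (by have := (Finset.mem_Icc.1 hh).1; omega) hx
  have hfs : Summable f := summable_sum hsingle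
  have h1 : ∑ h ∈ Finset.Icc 1 L, singSeries k x h = ∑' q, f q :=
    (Summable.tsum_finsetSum hsingle).symm
  have hfq : ∀ q : ℕ+, f q = (∑ h ∈ Finset.Icc 1 L, (ramanujanSum (q : ℕ) h : ℂ)) /
      ((q : ℕ) : ℂ) ^ 2 * Q k x (q : ℕ) ^ 2 := by
    intro q
    simp only [hf, singTerm, Finset.sum_div, Finset.sum_mul]
  have hf1 : f 1 = L * mainDeriv k x ^ 2 := by
    rw [hfq, PNat.one_coe, Q_one k hx0]
    simp [ramanujanSum]
  rw [h1, hfs.tsum_eq_add_tsum_ite 1, hf1, add_sub_cancel_left]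
  have hb : ∀ q : ℕ+, ‖(if q = 1 then 0 else f q : ℂ)‖ ≤
      B * A ^ 2 * x ^ δ * (L : ℝ) ^ δ * ((q : ℕ) : ℝ) ^ (-1 - r) := by
    intro q
    split_ifs with hq
    · rw [norm_zero]; positivity
    have hq2 : 2 ≤ (q : ℕ) := by
      have h1 := q.pos
      have h2 : (q : ℕ) ≠ 1 := fun h => hq (PNat.coe_eq_one_iff.1 h)
      omega
    have hq0 : (0 : ℝ) < ((q : ℕ) : ℝ) := by exact_mod_cast q.pos
    rw [hfq, norm_mul, norm_div, norm_pow, norm_pow, Complex.norm_natCast]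
    have e1 := norm_sum_ramanujanSum_le hq2 L h0.le (by linarith)
    have e2 := hB q q.pos.ne'
    have e3 := hA q q.pos.ne' x hx
    calc _ ≤ ((B * ((q : ℕ) : ℝ) ^ r) * (((q : ℕ) : ℝ) ^ (1 - δ) * (L : ℝ) ^ δ)) /
            ((q : ℕ) : ℝ) ^ 2 * (A * x ^ r * ((q : ℕ) : ℝ) ^ r) ^ 2 := by
          gcongr
          exact e1.trans (by gcongr)
      _ = B * A ^ 2 * (x ^ r * x ^ r) * (L : ℝ) ^ δ * (((q : ℕ) : ℝ) ^ r *
            ((q : ℕ) : ℝ) ^ (1 - δ) * (((q : ℕ) : ℝ) ^ (2 : ℝ))⁻¹ * ((q : ℕ) : ℝ) ^ r *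
            ((q : ℕ) : ℝ) ^ r) := by
          rw [Real.rpow_two]; ring
      _ = B * A ^ 2 * x ^ (r + r) * (L : ℝ) ^ δ * ((q : ℕ) : ℝ) ^ (-1 - r) := by
          rw [← Real.rpow_neg hq0.le, ← Real.rpow_add hq0, ← Real.rpow_add hq0,
            ← Real.rpow_add hq0, ← Real.rpow_add hq0, ← Real.rpow_add hx0]
          congr 2
          rw [hr]; ring
      _ ≤ _ := by
          gcongr
          rw [hr]; linarith
  calc _ ≤ _ := tsum_of_norm_bounded (hsum.hasSum.mul_left _) hb
    _ = B * A ^ 2 * Z * x ^ δ * (L : ℝ) ^ δ := by ring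
    _ ≤ _ := by gcongr; linarith

/-! ### The error term in the divisor problem -/

lemma divErr_eq (k : ℕ) (x : ℝ) : divErr k x = (divSum k x : ℂ) - mainTerm k x := rfl

lemma divSum_sub_divSum (k : ℕ) {x y : ℝ} (hxy : x ≤ y) :
    (divSum k y : ℂ) - divSum k x = ((∑ n ∈ Finset.Ioc ⌊x⌋₊ ⌊y⌋₊, divFun k n : ℕ) : ℂ) := by
  have hf : ⌊x⌋₊ ≤ ⌊y⌋₊ := Nat.floor_le_floor hxy
  have h : ∑ n ∈ Finset.Icc 1 ⌊x⌋₊, divFun k n + ∑ n ∈ Finset.Ioc ⌊x⌋₊ ⌊y⌋₊, divFun k n =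
      ∑ n ∈ Finset.Icc 1 ⌊y⌋₊, divFun k n := by
    have e : ∀ m : ℕ, Finset.Icc 1 m = Finset.Ioc 0 m := fun m => rfl
    rw [e, e]
    exact Finset.sum_Ioc_consecutive _ (Nat.zero_le _) hf
  unfold divSum
  rw [← h]
  push_cast
  ring

lemma exists_norm_divSum_sub_le (k : ℕ) {δ : ℝ} (h0 : 0 < δ) :
    ∃ C : ℝ, 0 < C ∧ ∀ x y X : ℝ, 1 ≤ x → x ≤ y → y ≤ X →
      ‖(divSum k y : ℂ) - divSum k x‖ ≤ C * X ^ δ * (y - x + 1) := by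
  obtain ⟨C, hC0, hC⟩ := exists_divFun_le k h0
  refine ⟨C, hC0, fun x y X hx hxy hy => ?_⟩
  rw [divSum_sub_divSum k hxy, Complex.norm_natCast]
  push_cast
  have hX : 0 < X := by linarith
  calc ∑ n ∈ Finset.Ioc ⌊x⌋₊ ⌊y⌋₊, (divFun k n : ℝ)
      ≤ (Finset.Ioc ⌊x⌋₊ ⌊y⌋₊).card • (C * X ^ δ) := by
        refine Finset.sum_le_card_nsmul _ _ _ fun n hn => ?_
        have hn := Finset.mem_Ioc.1 hn
        have hnX : (n : ℝ) ≤ X := ((Nat.le_floor_iff (by linarith)).1 hn.2).trans hy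
        exact (hC n (by omega)).trans (by gcongr)
    _ = C * X ^ δ * ((⌊y⌋₊ : ℝ) - ⌊x⌋₊) := by
        rw [nsmul_eq_mul, Nat.card_Ioc, Nat.cast_sub (Nat.floor_le_floor hxy)]
        ring
    _ ≤ _ := by
        gcongr
        have h1 := Nat.floor_le (show 0 ≤ y by linarith)
        have h2 := Nat.lt_floor_add_one x
        linarith

lemma exists_norm_mainDeriv_le_rpow (k : ℕ) {δ : ℝ} (h0 : 0 < δ) :
    ∃ C : ℝ, 0 < C ∧ ∀ x : ℝ, 1 ≤ x → ‖mainDeriv k x‖ ≤ C * x ^ δ := by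
  obtain ⟨C, hC0, hC⟩ := exists_norm_mainDeriv_le k (r := min δ (1 / 8))
    (lt_min h0 (by norm_num)) (min_le_right _ _)
  refine ⟨C, hC0, fun x hx => (hC x hx).trans ?_⟩
  gcongr
  exact min_le_left _ _

lemma exists_norm_mainTerm_sub_le (k : ℕ) {δ : ℝ} (h0 : 0 < δ) :
    ∃ C : ℝ, 0 < C ∧ ∀ x y X : ℝ, 1 ≤ x → x ≤ y → y ≤ X →
      ‖mainTerm k y - mainTerm k x‖ ≤ C * X ^ δ * (y - x) := by
  obtain ⟨C, hC0, hC⟩ := exists_norm_mainDeriv_le_rpow k h0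
  refine ⟨C, hC0, fun x y X hx hxy hy => ?_⟩
  have := (convex_Icc x y).norm_image_sub_le_of_norm_hasDerivWithin_le (f := mainTerm k)
    (f' := mainDeriv k) (C := C * X ^ δ)
    (fun t ht => (hasDerivAt_mainTerm k (by linarith [ht.1])).hasDerivWithinAt)
    (fun t ht => ?_) (Set.left_mem_Icc.2 hxy) (Set.right_mem_Icc.2 hxy)
  · rwa [Real.norm_of_nonneg (by linarith)] at this
  · have h1 : 1 ≤ t := by linarith [ht.1]
    have h2 : t ≤ X := by linarith [ht.2]
    exact (hC t h1).trans (by gcongr)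

/-- An interval of length `y - x` contains at most `y - x + 1` integers, each with `d_k(n) ≪ X^δ`,
and the main term has derivative `≪ X^δ`. -/
theorem exists_norm_divErr_sub_le (k : ℕ) {δ : ℝ} (h0 : 0 < δ) :
    ∃ C : ℝ, 0 < C ∧ ∀ x y X : ℝ, 1 ≤ x → x ≤ y → y ≤ X →
      ‖divErr k y - divErr k x‖ ≤ C * X ^ δ * (y - x + 1) := by
  obtain ⟨A, hA0, hA⟩ := exists_norm_divSum_sub_le k h0
  obtain ⟨B, hB0, hB⟩ := exists_norm_mainTerm_sub_le k h0
  refine ⟨A + B, by positivity, fun x y X hx hxy hy => ?_⟩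
  have hX : 0 < X := by linarith
  have e : divErr k y - divErr k x =
      ((divSum k y : ℂ) - divSum k x) - (mainTerm k y - mainTerm k x) := by
    rw [divErr_eq, divErr_eq]; ring
  rw [e]
  have h3 : B * X ^ δ * (y - x) ≤ B * X ^ δ * (y - x + 1) := by gcongr; linarith
  calc _ ≤ _ := norm_sub_le _ _
    _ ≤ A * X ^ δ * (y - x + 1) + B * X ^ δ * (y - x + 1) :=
        add_le_add (hA x y X hx hxy hy) ((hB x y X hx hxy hy).trans h3)
    _ = _ := by ring

lemma exists_norm_divErr_le (k : ℕ) {δ : ℝ} (h0 : 0 < δ) :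
    ∃ C : ℝ, 0 < C ∧ ∀ x X : ℝ, 1 ≤ x → x ≤ X → ‖divErr k x‖ ≤ C * X ^ (1 + δ) := by
  obtain ⟨C, hC0, hC⟩ := exists_norm_divErr_sub_le k h0
  refine ⟨‖divErr k 1‖ + C, by positivity, fun x X hx hX => ?_⟩
  have hX0 : 1 ≤ X := hx.trans hX
  have h1 := hC 1 x X le_rfl hx hX
  have h2 : C * X ^ δ * (x - 1 + 1) ≤ C * X ^ (1 + δ) := by
    rw [Real.rpow_add (by linarith), Real.rpow_one, mul_comm X, ← mul_assoc]
    gcongr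
    linarith
  have h3 : ‖divErr k 1‖ ≤ ‖divErr k 1‖ * X ^ (1 + δ) :=
    le_mul_of_one_le_right (norm_nonneg _) (Real.one_le_rpow hX0 (by linarith))
  calc ‖divErr k x‖ = ‖divErr k 1 + (divErr k x - divErr k 1)‖ := by rw [add_sub_cancel]
    _ ≤ ‖divErr k 1‖ + ‖divErr k x - divErr k 1‖ := norm_add_le _ _
    _ ≤ _ := by linarith

lemma measurable_divSum (k : ℕ) : Measurable fun x : ℝ => (divSum k x : ℂ) :=
  (measurable_from_nat (f := fun m : ℕ => ((∑ n ∈ Finset.Icc 1 m, divFun k n : ℕ) : ℂ))).comp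
    Nat.measurable_floor

lemma continuousOn_mainTerm (k : ℕ) (a b : ℝ) (ha : 1 ≤ a) :
    ContinuousOn (mainTerm k) (Set.Icc a b) := fun x hx =>
  (hasDerivAt_mainTerm k (by linarith [hx.1])).continuousAt.continuousWithinAt

lemma aestronglyMeasurable_divErr (k : ℕ) {a : ℝ} (ha : 1 ≤ a) (b : ℝ) :
    AEStronglyMeasurable (divErr k) (volume.restrict (Set.Icc a b)) :=
  (measurable_divSum k).aestronglyMeasurable.sub
    ((continuousOn_mainTerm k a b ha).aestronglyMeasurable measurableSet_Icc)

lemma integrableOn_divErr (k : ℕ) {a : ℝ} (ha : 1 ≤ a) (b : ℝ) :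
    IntegrableOn (divErr k) (Set.Icc a b) := by
  obtain ⟨C, hC0, hC⟩ := exists_norm_divErr_le k one_pos
  refine IntegrableOn.of_bound (by simp) (aestronglyMeasurable_divErr k ha b)
    (C * b ^ (1 + 1 : ℝ)) ?_
  exact (ae_restrict_iff' measurableSet_Icc).2 (Eventually.of_forall fun x hx =>
    hC x b (ha.trans hx.1) hx.2)

lemma integrableOn_norm_divErr_sq (k : ℕ) {a : ℝ} (ha : 1 ≤ a) (b : ℝ) :
    IntegrableOn (fun x => ‖divErr k x‖ ^ 2) (Set.Icc a b) := by
  obtain ⟨C, hC0, hC⟩ := exists_norm_divErr_le k one_pos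
  refine IntegrableOn.of_bound (by simp) ((aestronglyMeasurable_divErr k ha b).norm.pow 2)
    ((C * b ^ (1 + 1 : ℝ)) ^ 2) ?_
  refine (ae_restrict_iff' measurableSet_Icc).2 (Eventually.of_forall fun x hx => ?_)
  rw [norm_pow, norm_norm]
  exact pow_le_pow_left₀ (norm_nonneg _) (hC x b (ha.trans hx.1) hx.2) 2

lemma intervalIntegrable_divErr (k : ℕ) {a b : ℝ} (ha : 1 ≤ a) (hab : a ≤ b) :
    IntervalIntegrable (divErr k) volume a b :=
  (intervalIntegrable_iff_integrableOn_Icc_of_le hab).2 (integrableOn_divErr k ha b)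

lemma intervalIntegrable_norm_divErr_sq (k : ℕ) {a b : ℝ} (ha : 1 ≤ a) (hab : a ≤ b) :
    IntervalIntegrable (fun x => ‖divErr k x‖ ^ 2) volume a b :=
  (intervalIntegrable_iff_integrableOn_Icc_of_le hab).2 (integrableOn_norm_divErr_sq k ha b)

/-- Since `Δ_k` varies slowly, its value at a point is controlled by its mean to the right. -/
theorem exists_mul_norm_divErr_le (k : ℕ) {δ : ℝ} (h0 : 0 < δ) :
    ∃ C : ℝ, 0 < C ∧ ∀ x u X : ℝ, 1 ≤ x → 1 ≤ u → x + u ≤ X →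
      u * ‖divErr k x‖ ≤ (∫ y in x..(x + u), ‖divErr k y‖) + C * X ^ δ * u ^ 2 := by
  obtain ⟨C, hC0, hC⟩ := exists_norm_divErr_sub_le k h0
  refine ⟨C * 2, by positivity, fun x u X hx hu hX => ?_⟩
  have hX0 : 0 < X := by linarith
  have hint := (intervalIntegrable_divErr k hx (show x ≤ x + u by linarith)).norm
  have h1 : ∫ _y in x..(x + u), ‖divErr k x‖ ≤
      ∫ y in x..(x + u), (‖divErr k y‖ + C * X ^ δ * (2 * u)) := by
    refine intervalIntegral.integral_mono_on (by linarith) intervalIntegrable_const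
      (hint.add intervalIntegrable_const) fun y hy => ?_
    have h2 := hC x y X hx hy.1 (hy.2.trans hX)
    have h3 : C * X ^ δ * (y - x + 1) ≤ C * X ^ δ * (2 * u) := by
      have := hy.2
      gcongr
      linarith
    have h4 := norm_sub_norm_le (divErr k x) (divErr k y)
    rw [norm_sub_rev] at h4
    linarith
  rw [intervalIntegral.integral_add hint intervalIntegrable_const] at h1
  simp only [intervalIntegral.integral_const, add_sub_cancel_left, smul_eq_mul] at h1
  linarith

/-! ### The mean-square exponent -/

/-- The set of exponents whose infimum is `β_k`. -/
def betaSet (k : ℕ) : Set ℝ :=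
  {b : ℝ | (fun X : ℝ => ∫ x in (1 : ℝ)..X, ‖divErr k x‖ ^ 2)
    =O[atTop] fun X : ℝ => X ^ (1 + 2 * b)}

/-- The trivial bound `Δ_k ≪ X²` gives `X⁵ = X^(1 + 2·2)`. Nonemptiness ensures that `beta k` is not
the default value of `sInf` at the empty set. -/
lemma two_mem_betaSet (k : ℕ) : (2 : ℝ) ∈ betaSet k := by
  obtain ⟨C, hC0, hC⟩ := exists_norm_divErr_le k one_pos
  refine IsBigO.of_bound (C ^ 2) ?_
  filter_upwards [eventually_ge_atTop 1] with X hX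
  have h1 := intervalIntegral.norm_integral_le_of_norm_le_const (a := 1) (b := X)
    (f := fun x => ‖divErr k x‖ ^ 2) (C := (C * X ^ (1 + 1 : ℝ)) ^ 2) fun x hx => by
      rw [Set.uIoc_of_le hX] at hx
      rw [norm_pow, norm_norm]
      exact pow_le_pow_left₀ (norm_nonneg _) (hC x X hx.1.le hx.2) 2
  rw [abs_of_nonneg (by linarith)] at h1
  have hX0 : 0 < X := by linarith
  have e1 : X ^ (1 + 1 : ℝ) = X ^ 2 := by rw [← Real.rpow_natCast]; norm_num
  have e2 : X ^ (1 + 2 * 2 : ℝ) = X ^ 5 := by rw [← Real.rpow_natCast]; norm_num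
  rw [e1] at h1
  rw [e2, Real.norm_of_nonneg (by positivity : 0 ≤ X ^ 5)]
  calc _ ≤ _ := h1
    _ ≤ (C * X ^ 2) ^ 2 * X := by gcongr; linarith
    _ = _ := by ring

lemma exists_integral_sq_le {k : ℕ} {b : ℝ} (hb : b ∈ betaSet k) :
    ∃ C X₀ : ℝ, 0 < C ∧ 1 ≤ X₀ ∧ ∀ X : ℝ, X₀ ≤ X →
      ∫ x in (1 : ℝ)..X, ‖divErr k x‖ ^ 2 ≤ C * X ^ (1 + 2 * b) := by
  obtain ⟨C, hC0, hC⟩ := hb.exists_pos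
  obtain ⟨X₀, hX₀⟩ := eventually_atTop.1 hC.bound
  refine ⟨C, max X₀ 1, hC0, le_max_right _ _, fun X hX => ?_⟩
  have h := hX₀ X ((le_max_left _ _).trans hX)
  have hX1 : 1 ≤ X := (le_max_right _ _).trans hX
  rw [Real.norm_of_nonneg (show 0 ≤ X ^ (1 + 2 * b) by positivity)] at h
  exact (le_abs_self _).trans h

lemma floor_add_half {n : ℕ} {t : ℝ} (h0 : 0 ≤ t) (h1 : t ≤ 1 / 2) : ⌊(n : ℝ) + t⌋₊ = n := by
  rw [Nat.floor_eq_iff (by positivity)]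
  constructor <;> linarith

lemma floor_sub_half {n : ℕ} (hn : n ≠ 0) {t : ℝ} (h0 : 0 < t) (h1 : t ≤ 1 / 2) :
    ⌊(n : ℝ) - t⌋₊ = n - 1 := by
  obtain ⟨m, rfl⟩ := Nat.exists_eq_succ_of_ne_zero hn
  rw [Nat.succ_sub_one, Nat.floor_eq_iff]
  · push_cast
    constructor <;> linarith
  · push_cast
    have : (0 : ℝ) ≤ m := Nat.cast_nonneg m
    linarith

/-- The jump of `Δ_k` at every integer forces a lower bound for its mean square. -/
lemma exists_le_integral_sq_near_nat {k : ℕ} (hk : k ≠ 0) {δ : ℝ} (h0 : 0 < δ) :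
    ∃ c : ℝ, 0 < c ∧ ∀ (n : ℕ) (X : ℝ), 2 ≤ n → (n : ℝ) + 1 ≤ X →
      c * X ^ (-δ) ≤ ∫ x in ((n : ℝ) - 1 / 2)..((n : ℝ) + 1 / 2), ‖divErr k x‖ ^ 2 := by
  obtain ⟨C, hC0, hC⟩ := exists_norm_mainTerm_sub_le k h0
  -- Across `[n - η, n + η]` with `η = c X^(-δ)` the main term moves by at most `1/2`, while the
  -- divisor sum jumps by `d_k(n) ≥ 1`. Hence `|Δ_k(n + t)| + |Δ_k(n - t)| ≥ 1/2`. The bound `c ≤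
  -- 1/2` keeps the window inside `[n - 1/2, n + 1/2]`.
  set c := min (1 / 2) (1 / (4 * C)) with hc
  have hc0 : 0 < c := by positivity
  refine ⟨c / 8, by positivity, fun n X hn hX => ?_⟩
  have hn2 : (2 : ℝ) ≤ n := by exact_mod_cast hn
  have hX1 : 1 ≤ X := by linarith
  have hX0 : 0 < X := by linarith
  set η := c * X ^ (-δ) with hη
  have hη0 : 0 < η := by positivity
  have hη1 : η ≤ 1 / 2 := by
    have h1 : X ^ (-δ) ≤ 1 := Real.rpow_le_one_of_one_le_of_nonpos hX1 (by linarith)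
    have h2 : c ≤ 1 / 2 := min_le_left _ _
    calc η ≤ 1 / 2 * 1 := by rw [hη]; gcongr
      _ = 1 / 2 := by norm_num
  have hη2 : C * X ^ δ * η ≤ 1 / 4 := by
    have h1 : X ^ δ * X ^ (-δ) = 1 := by rw [← Real.rpow_add hX0]; simp
    have h2 : c ≤ 1 / (4 * C) := min_le_right _ _
    calc C * X ^ δ * η = C * c * (X ^ δ * X ^ (-δ)) := by rw [hη]; ring
      _ ≤ C * (1 / (4 * C)) * (X ^ δ * X ^ (-δ)) := by gcongr
      _ = 1 / 4 := by rw [h1]; field_simp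
  have hpt : ∀ t ∈ Set.Ioo (0 : ℝ) η,
      (1 / 8 : ℝ) ≤ ‖divErr k (n + t)‖ ^ 2 + ‖divErr k (n - t)‖ ^ 2 := by
    intro t ht
    have hle : (n : ℝ) - t ≤ n + t := by linarith [ht.1]
    have h1 := hC (n - t) (n + t) X (by linarith [ht.2]) hle (by linarith [ht.2])
    have h2 : (divSum k (n + t) : ℂ) - divSum k (n - t) = (divFun k n : ℂ) := by
      rw [divSum_sub_divSum k hle, floor_add_half ht.1.le (by linarith [ht.2]),
        floor_sub_half (by omega) ht.1 (by linarith [ht.2])]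
      have : Finset.Ioc (n - 1) n = {n} := by
        ext m; simp only [Finset.mem_Ioc, Finset.mem_singleton]; omega
      rw [this, Finset.sum_singleton]
    have h3 : (1 : ℝ) ≤ ‖(divFun k n : ℂ)‖ := by
      rw [Complex.norm_natCast]; exact_mod_cast divFun_pos hk (by omega)
    have h4 : C * X ^ δ * ((n + t) - (n - t)) ≤ 1 / 2 := by
      have : C * X ^ δ * ((n + t) - (n - t)) = 2 * (C * X ^ δ * t) := by ring
      have h5 : C * X ^ δ * t ≤ C * X ^ δ * η := by
        have := ht.2.le
        gcongr
      linarith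
    have h6 : (divFun k n : ℂ) = (divErr k (n + t) - divErr k (n - t)) +
        (mainTerm k (n + t) - mainTerm k (n - t)) := by
      rw [divErr_eq, divErr_eq, ← h2]; ring
    have h7 : ‖(divFun k n : ℂ)‖ ≤ ‖divErr k (n + t)‖ + ‖divErr k (n - t)‖ +
        ‖mainTerm k (n + t) - mainTerm k (n - t)‖ := by
      rw [h6]
      refine (norm_add_le _ _).trans ?_
      gcongr
      exact norm_sub_le _ _
    have h8 : 1 / 2 ≤ ‖divErr k (n + t)‖ + ‖divErr k (n - t)‖ := by linarith
    nlinarith [sq_nonneg (‖divErr k (n + t)‖ - ‖divErr k (n - t)‖)]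
  have hI : ∀ a b : ℝ, 1 ≤ a → a ≤ b →
      IntervalIntegrable (fun x => ‖divErr k x‖ ^ 2) volume a b := fun a b ha hab =>
    intervalIntegrable_norm_divErr_sq k ha hab
  have i1 : IntervalIntegrable (fun t => ‖divErr k (n + t)‖ ^ 2) volume 0 η := by
    have := (hI n (n + η) (by linarith) (by linarith)).comp_add_left (n : ℝ)
    simpa using this
  have i2 : IntervalIntegrable (fun t => ‖divErr k (n - t)‖ ^ 2) volume 0 η := by
    have := ((hI (n - η) n (by linarith) (by linarith)).comp_sub_left (n : ℝ)).symm
    simpa using this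
  have h1 : ∫ _t in (0 : ℝ)..η, (1 / 8 : ℝ) ≤
      ∫ t in (0 : ℝ)..η, (‖divErr k (n + t)‖ ^ 2 + ‖divErr k (n - t)‖ ^ 2) :=
    intervalIntegral.integral_mono_on_of_le_Ioo hη0.le intervalIntegrable_const (i1.add i2) hpt
  rw [intervalIntegral.integral_add i1 i2,
    intervalIntegral.integral_comp_add_left (fun x => ‖divErr k x‖ ^ 2),
    intervalIntegral.integral_comp_sub_left (fun x => ‖divErr k x‖ ^ 2), add_comm,
    sub_zero, add_zero,
    intervalIntegral.integral_add_adjacent_intervals (hI _ _ (by linarith) (by linarith))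
      (hI _ _ (by linarith) (by linarith))] at h1
  simp only [intervalIntegral.integral_const, sub_zero, smul_eq_mul] at h1
  calc c / 8 * X ^ (-δ) = η * (1 / 8) := by rw [hη]; ring
    _ ≤ _ := h1
    _ ≤ _ := intervalIntegral.integral_mono_interval (by linarith) (by linarith) (by linarith)
      (Eventually.of_forall fun _ => by positivity) (hI _ _ (by linarith) (by linarith))

lemma exists_le_integral_sq {k : ℕ} (hk : k ≠ 0) {δ : ℝ} (h0 : 0 < δ) :
    ∃ c : ℝ, 0 < c ∧ ∀ m : ℕ,
      c * m * (m + 3 : ℝ) ^ (-δ) ≤ ∫ x in (1 : ℝ)..(m + 3 : ℝ), ‖divErr k x‖ ^ 2 := by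
  obtain ⟨c, hc0, hc⟩ := exists_le_integral_sq_near_nat hk h0
  refine ⟨c, hc0, fun m => ?_⟩
  have hI : ∀ a b : ℝ, 1 ≤ a → a ≤ b →
      IntervalIntegrable (fun x => ‖divErr k x‖ ^ 2) volume a b := fun a b ha hab =>
    intervalIntegrable_norm_divErr_sq k ha hab
  -- Unit intervals `[i + 3/2, i + 5/2]` centred at the integers `i + 2`, all inside `[1, m + 3]`.
  have h1 := intervalIntegral.sum_integral_adjacent_intervals (n := m)
    (f := fun x => ‖divErr k x‖ ^ 2) (μ := volume) (a := fun i : ℕ => (i : ℝ) + 3 / 2)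
    fun i _ => hI _ _ (by linarith [(Nat.cast_nonneg i : (0 : ℝ) ≤ i)]) (by push_cast; linarith)
  have hm : (0 : ℝ) ≤ m := Nat.cast_nonneg m
  calc c * m * (m + 3 : ℝ) ^ (-δ) = ∑ _i ∈ Finset.range m, c * (m + 3 : ℝ) ^ (-δ) := by
        rw [Finset.sum_const, Finset.card_range, nsmul_eq_mul]; ring
    _ ≤ ∑ i ∈ Finset.range m, ∫ x in ((i : ℝ) + 3 / 2)..(((i + 1 : ℕ) : ℝ) + 3 / 2),
          ‖divErr k x‖ ^ 2 := by
        refine Finset.sum_le_sum fun i hi => ?_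
        have hi : ((i + 1 : ℕ) : ℝ) ≤ m := by exact_mod_cast Finset.mem_range.1 hi
        have := hc (i + 2) (m + 3) (by omega) (by push_cast at hi ⊢; linarith)
        refine this.trans (le_of_eq ?_)
        congr 1 <;> push_cast <;> ring
    _ = _ := h1
    _ ≤ _ := by
        refine intervalIntegral.integral_mono_interval (by norm_num) ?_ (by linarith)
          (Eventually.of_forall fun _ => by positivity) (hI _ _ le_rfl (by linarith))
        push_cast
        linarith

/-- If `b < 0`, the jumps with `δ = -b` give a lower bound of order `X^(1+b)`, which contradicts the
upper bound `X^(1+2b)`. Nonnegativity is what allows `N ≤ N^(1+b)` later. -/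
lemma nonneg_of_mem_betaSet {k : ℕ} (hk : k ≠ 0) {b : ℝ} (hb : b ∈ betaSet k) : 0 ≤ b := by
  by_contra! hneg
  obtain ⟨C, X₀, hC0, hX₀, hC⟩ := exists_integral_sq_le hb
  obtain ⟨c, hc0, hc⟩ := exists_le_integral_sq hk (δ := -b) (by linarith)
  have hlim : Tendsto (fun m : ℕ => C * 4 / c * ((m : ℝ) + 3) ^ b) atTop (𝓝 (C * 4 / c * 0)) := by
    refine Tendsto.const_mul _ ?_
    have h := (tendsto_rpow_neg_atTop (y := -b) (by linarith)).comp
      (tendsto_atTop_add_const_right atTop (3 : ℝ) tendsto_natCast_atTop_atTop)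
    simpa [Function.comp_def] using h
  rw [mul_zero] at hlim
  have hev := (hlim.eventually (gt_mem_nhds one_pos)).and
    ((eventually_ge_atTop 1).and
      (tendsto_natCast_atTop_atTop.eventually (eventually_ge_atTop X₀)))
  obtain ⟨m, hm, hm1, hmX⟩ := hev.exists
  have hm1' : (1 : ℝ) ≤ m := by exact_mod_cast hm1
  set X : ℝ := m + 3
  have hX0 : 0 < X := by positivity
  have h1 := (hc m).trans (hC X (by linarith))
  rw [neg_neg] at h1
  have h2 : X ^ (1 + 2 * b) = X * X ^ b * X ^ b := by
    rw [two_mul, Real.rpow_add hX0, Real.rpow_add hX0, Real.rpow_one]; ring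
  rw [h2] at h1
  have hXb : 0 < X ^ b := by positivity
  have h3 : c * m ≤ C * X * X ^ b := by
    refine le_of_mul_le_mul_right ?_ hXb
    linarith
  have h4 : X ≤ 4 * m := by simp only [X]; linarith
  have h5 : c * m ≤ C * 4 * X ^ b * m := by
    calc c * m ≤ C * X * X ^ b := h3
      _ ≤ C * (4 * m) * X ^ b := by gcongr
      _ = _ := by ring
  have h6 : c ≤ C * 4 * X ^ b := le_of_mul_le_mul_right h5 (by linarith)
  have h7 : C * 4 / c * X ^ b = C * 4 * X ^ b / c := by ring
  rw [h7, div_lt_one hc0] at hm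
  linarith

lemma exists_mem_betaSet_lt (k : ℕ) {η : ℝ} (hη : 0 < η) : ∃ b ∈ betaSet k, b < beta k + η :=
  exists_lt_of_csInf_lt ⟨2, two_mem_betaSet k⟩ (show sInf (betaSet k) < beta k + η by
    change beta k < _; linarith)

/-- Instead of Cauchy–Schwarz, the pointwise inequality `|Δ_k| ≤ X^b + |Δ_k|² X^(-b)` is integrated.
The constant `K` takes care of `X` below the threshold `X₀`. -/
theorem exists_integral_norm_divErr_le {k : ℕ} (hk : k ≠ 0) {b : ℝ} (hb : b ∈ betaSet k) :
    ∃ C : ℝ, 0 < C ∧ ∀ X : ℝ, 1 ≤ X →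
      ∫ x in (1 : ℝ)..X, ‖divErr k x‖ ≤ C * X ^ (1 + b) := by
  obtain ⟨C, X₀, hC0, hX₀, hC⟩ := exists_integral_sq_le hb
  have hb0 := nonneg_of_mem_betaSet hk hb
  set K := ∫ x in (1 : ℝ)..X₀, ‖divErr k x‖ ^ 2
  have hK0 : 0 ≤ K := intervalIntegral.integral_nonneg hX₀ fun _ _ => by positivity
  have hsq : ∀ X : ℝ, 1 ≤ X →
      ∫ x in (1 : ℝ)..X, ‖divErr k x‖ ^ 2 ≤ (C + K) * X ^ (1 + 2 * b) := by
    intro X hX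
    have hXp : 1 ≤ X ^ (1 + 2 * b) := Real.one_le_rpow hX (by linarith)
    rcases le_total X₀ X with h | h
    · exact (hC X h).trans (by gcongr; linarith)
    · have : ∫ x in (1 : ℝ)..X, ‖divErr k x‖ ^ 2 ≤ K :=
        intervalIntegral.integral_mono_interval le_rfl hX h
          (Eventually.of_forall fun _ => by positivity)
          (intervalIntegrable_norm_divErr_sq k le_rfl hX₀)
      nlinarith
  refine ⟨1 + (C + K), by positivity, fun X hX => ?_⟩
  have hX0 : 0 < X := by linarith
  have hXb : 0 < X ^ b := by positivity
  have i2 := (intervalIntegrable_norm_divErr_sq k le_rfl hX).mul_const (X ^ (-b))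
  calc ∫ x in (1 : ℝ)..X, ‖divErr k x‖
      ≤ ∫ x in (1 : ℝ)..X, (X ^ b + ‖divErr k x‖ ^ 2 * X ^ (-b)) := by
        refine intervalIntegral.integral_mono_on hX (intervalIntegrable_divErr k le_rfl hX).norm
          (intervalIntegrable_const.add i2) fun x _ => ?_
        rw [Real.rpow_neg hX0.le, ← div_eq_mul_inv]
        have : ‖divErr k x‖ - X ^ b ≤ ‖divErr k x‖ ^ 2 / X ^ b := by
          rw [le_div_iff₀ hXb]
          nlinarith [sq_nonneg (‖divErr k x‖ - X ^ b), norm_nonneg (divErr k x)]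
        linarith
    _ = (X - 1) * X ^ b + (∫ x in (1 : ℝ)..X, ‖divErr k x‖ ^ 2) * X ^ (-b) := by
        rw [intervalIntegral.integral_add intervalIntegrable_const i2,
          intervalIntegral.integral_const, intervalIntegral.integral_mul_const, smul_eq_mul]
    _ ≤ X * X ^ b + ((C + K) * X ^ (1 + 2 * b)) * X ^ (-b) := by
        gcongr
        · linarith
        · exact hsq X hX
    _ = X ^ (1 + b) + (C + K) * (X ^ (1 + 2 * b) * X ^ (-b)) := by
        rw [Real.rpow_add hX0 1 b, Real.rpow_one]; ring
    _ = _ := by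
        rw [← Real.rpow_add hX0, show 1 + 2 * b + -b = 1 + b by ring]; ring

/-! ### Averages of the correlation sums -/

lemma four_mul_rpow_le {N δ : ℝ} (hN : 0 ≤ N) (h1 : δ ≤ 1) :
    (4 * N) ^ δ ≤ 4 * N ^ δ := by
  rw [Real.mul_rpow (by norm_num) hN]
  gcongr
  calc (4 : ℝ) ^ δ ≤ 4 ^ (1 : ℝ) := Real.rpow_le_rpow_of_exponent_le (by norm_num) h1
    _ = 4 := Real.rpow_one 4

lemma sum_corrSum (k : ℕ) (N : ℝ) (L : ℕ) :
    ((∑ h ∈ Finset.Icc 1 L, corrSum k N h : ℕ) : ℂ) =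
      ∑ n ∈ Finset.Ioc ⌊N⌋₊ ⌊2 * N⌋₊,
        (divFun k n : ℂ) * ((divSum k (n + L : ℝ) : ℂ) - divSum k n) := by
  unfold corrSum
  rw [Finset.sum_comm, Nat.cast_sum]
  refine Finset.sum_congr rfl fun n _ => ?_
  rw [divSum_sub_divSum k (by simp), ← Finset.mul_sum, Nat.cast_mul, ← Nat.cast_add,
    Nat.floor_natCast, Nat.floor_natCast]
  congr 2
  refine Finset.sum_nbij' (fun h => n + h) (fun m => m - n) ?_ ?_ ?_ ?_ ?_
  · intro h hh
    simp only [Finset.mem_Icc, Finset.mem_Ioc] at hh ⊢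
    omega
  · intro m hm
    simp only [Finset.mem_Icc, Finset.mem_Ioc] at hm ⊢
    omega
  · intro h _
    omega
  · intro m hm
    simp only [Finset.mem_Ioc] at hm
    omega
  · intro h _
    rfl

/-- The range of `n` in the correlation sums has at most `2N` elements. -/
lemma card_range_le {N : ℝ} (hN : 1 ≤ N) :
    ((Finset.Ioc ⌊N⌋₊ ⌊2 * N⌋₊).card : ℝ) ≤ 2 * N := by
  rw [Nat.card_Ioc]
  exact (Nat.cast_le.2 (Nat.sub_le _ _)).trans (Nat.floor_le (by linarith))

lemma bounds_of_mem_range {N : ℝ} (hN : 1 ≤ N) {n : ℕ} (hn : n ∈ Finset.Ioc ⌊N⌋₊ ⌊2 * N⌋₊) :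
    N ≤ n ∧ (n : ℝ) ≤ 2 * N := by
  rw [Finset.mem_Ioc] at hn
  exact ⟨(Nat.lt_of_floor_lt hn.1).le, (Nat.le_floor_iff (by linarith)).1 hn.2⟩

lemma exists_divFun_le_range (k : ℕ) {δ : ℝ} (h0 : 0 < δ) (h1 : δ ≤ 1) :
    ∃ C : ℝ, 0 < C ∧ ∀ (N : ℝ) (n : ℕ), 1 ≤ N → n ∈ Finset.Ioc ⌊N⌋₊ ⌊2 * N⌋₊ →
      (divFun k n : ℝ) ≤ C * N ^ δ := by
  obtain ⟨C, hC0, hC⟩ := exists_divFun_le k h0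
  refine ⟨C * 4, by positivity, fun N n hN hn => ?_⟩
  have hb := bounds_of_mem_range hN hn
  have hn0 : n ≠ 0 := by have := (Finset.mem_Ioc.1 hn).1; omega
  calc (divFun k n : ℝ) ≤ C * (n : ℝ) ^ δ := hC n hn0
    _ ≤ C * (4 * N) ^ δ := by gcongr; linarith
    _ ≤ C * (4 * N ^ δ) := by gcongr; exact four_mul_rpow_le (by linarith) h1
    _ = _ := by ring

lemma exists_sum_norm_divErr_le {k : ℕ} (hk : k ≠ 0) {b : ℝ} (hb : b ∈ betaSet k) {δ : ℝ}
    (h0 : 0 < δ) (h1 : δ ≤ 1) :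
    ∃ C : ℝ, 0 < C ∧ ∀ (N : ℝ) (L : ℕ), 1 ≤ N → (L : ℝ) ≤ N →
      ∑ n ∈ Finset.Ioc ⌊N⌋₊ ⌊2 * N⌋₊, ‖divErr k (n + L : ℝ)‖ ≤ C * N ^ δ * N ^ (1 + b) := by
  obtain ⟨A, hA0, hA⟩ := exists_mul_norm_divErr_le k h0
  obtain ⟨B, hB0, hB⟩ := exists_integral_norm_divErr_le hk hb
  have hb0 := nonneg_of_mem_betaSet hk hb
  refine ⟨B * 4 ^ (1 + b) + 8 * A, by positivity, fun N L hN hL => ?_⟩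
  have hN0 : 0 < N := by linarith
  have hf1 : 1 ≤ ⌊N⌋₊ := Nat.le_floor (by exact_mod_cast hN)
  have hf2 : ⌊N⌋₊ ≤ ⌊2 * N⌋₊ := Nat.floor_le_floor (by linarith)
  have hf3 : (⌊2 * N⌋₊ : ℝ) ≤ 2 * N := Nat.floor_le (by linarith)
  have hL0 : (0 : ℝ) ≤ L := Nat.cast_nonneg L
  set F : ℝ → ℝ := fun x => ‖divErr k x‖ with hF
  have hI : ∀ a b : ℝ, 1 ≤ a → a ≤ b → IntervalIntegrable F volume a b := fun a b ha hab =>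
    (intervalIntegrable_divErr k ha hab).norm
  have hpt : ∀ n ∈ Finset.Ioc ⌊N⌋₊ ⌊2 * N⌋₊, F (n + L : ℝ) ≤
      (∫ y in ((n : ℝ) + L)..(((n + 1 : ℕ) : ℝ) + L), F y) + A * (4 * N) ^ δ := by
    intro n hn
    have hbd := bounds_of_mem_range hN hn
    -- A unit window to the right of each integer: the windows tile an interval within `[1, 4N]`,
    -- since `n + L + 1 ≤ 2N + N + N`.
    have := hA (n + L) 1 (4 * N) (by linarith) le_rfl (by linarith)
    rw [one_mul, one_pow, mul_one] at this
    rwa [show ((n + 1 : ℕ) : ℝ) + L = n + L + 1 by push_cast; ring]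
  have hIco : Finset.Ioc ⌊N⌋₊ ⌊2 * N⌋₊ = Finset.Ico (⌊N⌋₊ + 1) (⌊2 * N⌋₊ + 1) := by
    ext m; simp only [Finset.mem_Ioc, Finset.mem_Ico]; omega
  have hsum : ∑ n ∈ Finset.Ioc ⌊N⌋₊ ⌊2 * N⌋₊,
      (∫ y in ((n : ℝ) + L)..(((n + 1 : ℕ) : ℝ) + L), F y) ≤ ∫ y in (1 : ℝ)..(4 * N), F y := by
    rw [hIco, intervalIntegral.sum_integral_adjacent_intervals_Ico
      (a := fun n : ℕ => (n : ℝ) + L) (by omega)]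
    · refine intervalIntegral.integral_mono_interval ?_ ?_ ?_
        (Eventually.of_forall fun _ => norm_nonneg _) (hI _ _ le_rfl (by linarith))
      · push_cast
        have : (0 : ℝ) ≤ (⌊N⌋₊ : ℝ) := Nat.cast_nonneg _
        linarith
      · have : ((⌊N⌋₊ : ℕ) : ℝ) ≤ ⌊2 * N⌋₊ := by exact_mod_cast hf2
        push_cast
        linarith
      · push_cast
        linarith
    · intro j hj
      have : (1 : ℝ) ≤ j := by exact_mod_cast (show 1 ≤ j by have := hj.1; omega)
      refine hI _ _ (by linarith) ?_
      push_cast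
      linarith
  have hNN : N ≤ N ^ (1 + b) := by
    calc N = N ^ (1 : ℝ) := (Real.rpow_one N).symm
      _ ≤ _ := Real.rpow_le_rpow_of_exponent_le hN (by linarith)
  have hNδ : 1 ≤ N ^ δ := Real.one_le_rpow hN h0.le
  calc ∑ n ∈ Finset.Ioc ⌊N⌋₊ ⌊2 * N⌋₊, F (n + L : ℝ)
      ≤ ∑ n ∈ Finset.Ioc ⌊N⌋₊ ⌊2 * N⌋₊,
        ((∫ y in ((n : ℝ) + L)..(((n + 1 : ℕ) : ℝ) + L), F y) + A * (4 * N) ^ δ) :=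
        Finset.sum_le_sum hpt
    _ ≤ (∫ y in (1 : ℝ)..(4 * N), F y) + 2 * N * (A * (4 * N) ^ δ) := by
        rw [Finset.sum_add_distrib, Finset.sum_const, nsmul_eq_mul]
        gcongr
        exact card_range_le hN
    _ ≤ B * (4 * N) ^ (1 + b) + 2 * N * (A * (4 * N ^ δ)) := by
        gcongr
        · exact hB _ (by linarith)
        · exact four_mul_rpow_le hN0.le h1
    _ = B * 4 ^ (1 + b) * 1 * N ^ (1 + b) + 8 * A * N ^ δ * N := by
        rw [Real.mul_rpow (by norm_num) hN0.le]; ring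
    _ ≤ B * 4 ^ (1 + b) * N ^ δ * N ^ (1 + b) + 8 * A * N ^ δ * N ^ (1 + b) := by gcongr
    _ = _ := by ring

/-- The contribution of the error terms `Δ_k(n + L) - Δ_k(n)`. -/
lemma exists_norm_sum_divErr_le {k : ℕ} (hk : k ≠ 0) {b : ℝ} (hb : b ∈ betaSet k) {δ : ℝ}
    (h0 : 0 < δ) (h1 : δ ≤ 1) :
    ∃ C : ℝ, 0 < C ∧ ∀ (N : ℝ) (L : ℕ), 1 ≤ N → (L : ℝ) ≤ N →
      ‖∑ n ∈ Finset.Ioc ⌊N⌋₊ ⌊2 * N⌋₊,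
        (divFun k n : ℂ) * (divErr k (n + L : ℝ) - divErr k n)‖ ≤
          C * N ^ (2 * δ) * N ^ (1 + b) := by
  obtain ⟨A, hA0, hA⟩ := exists_sum_norm_divErr_le hk hb h0 h1
  obtain ⟨B, hB0, hB⟩ := exists_divFun_le_range k h0 h1
  refine ⟨B * (A + A), by positivity, fun N L hN hL => ?_⟩
  have hN0 : 0 < N := by linarith
  have e1 := hA N L hN hL
  have e2 := hA N 0 hN (by simpa using hN0.le)
  simp only [Nat.cast_zero, add_zero] at e2
  calc _ ≤ ∑ n ∈ Finset.Ioc ⌊N⌋₊ ⌊2 * N⌋₊,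
          B * N ^ δ * (‖divErr k (n + L : ℝ)‖ + ‖divErr k n‖) := by
        refine (norm_sum_le _ _).trans (Finset.sum_le_sum fun n hn => ?_)
        rw [norm_mul, Complex.norm_natCast]
        exact mul_le_mul (hB N n hN hn) (norm_sub_le _ _) (norm_nonneg _) (by positivity)
    _ ≤ B * N ^ δ * (A * N ^ δ * N ^ (1 + b) + A * N ^ δ * N ^ (1 + b)) := by
        rw [← Finset.mul_sum, Finset.sum_add_distrib]
        gcongr
    _ = _ := by rw [two_mul, Real.rpow_add hN0 δ δ]; ring

lemma exists_norm_mainTerm_taylor_le (k : ℕ) {δ : ℝ} (h0 : 0 < δ) (h1 : δ ≤ 1 / 8) :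
    ∃ C : ℝ, 0 < C ∧ ∀ N x u : ℝ, 1 ≤ N → N ≤ x → 0 ≤ u →
      ‖mainTerm k (x + u) - mainTerm k x - u * mainDeriv k x‖ ≤ C * N ^ (δ - 1) * u ^ 2 := by
  obtain ⟨C, hC0, hC⟩ := exists_norm_mainDeriv2_le k h0 h1
  refine ⟨C, hC0, fun N x u hN hx hu => ?_⟩
  have hN0 : 0 < N := by linarith
  have hD : ∀ t ∈ Set.Icc x (x + u),
      ‖mainDeriv k t - mainDeriv k x‖ ≤ C * N ^ (δ - 1) * u := by
    intro t ht
    have := (convex_Icc x (x + u)).norm_image_sub_le_of_norm_hasDerivWithin_le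
      (f := mainDeriv k) (f' := mainDeriv2 k) (C := C * N ^ (δ - 1))
      (fun y hy => (hasDerivAt_mainDeriv k (by linarith [hy.1])).hasDerivWithinAt)
      (fun y hy => ?_) (Set.left_mem_Icc.2 (by linarith)) ht
    · rw [Real.norm_of_nonneg (by linarith [ht.1])] at this
      refine this.trans ?_
      gcongr
      linarith [ht.2]
    · refine (hC y (by linarith [hy.1])).trans ?_
      have := Real.rpow_le_rpow_of_nonpos hN0 (hx.trans hy.1) (show δ - 1 ≤ 0 by linarith)
      gcongr
  -- The mean value inequality for `M(t) - t M'(x)`, whose derivative `M'(t) - M'(x)` has just been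
  -- bounded by `hD`.
  have := (convex_Icc x (x + u)).norm_image_sub_le_of_norm_hasDerivWithin_le
    (f := fun t : ℝ => mainTerm k t - (t : ℂ) * mainDeriv k x)
    (f' := fun t => mainDeriv k t - 1 * mainDeriv k x) (C := C * N ^ (δ - 1) * u)
    (fun y hy => ((hasDerivAt_mainTerm k (by linarith [hy.1])).sub
      ((hasDerivAt_id y).ofReal_comp.mul_const _)).hasDerivWithinAt)
    (fun y hy => by rw [one_mul]; exact hD y hy) (Set.left_mem_Icc.2 (by linarith))
    (Set.right_mem_Icc.2 (by linarith))
  rw [add_sub_cancel_left, Real.norm_of_nonneg hu] at this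
  calc _ = ‖mainTerm k (x + u) - ((x + u : ℝ) : ℂ) * mainDeriv k x -
        (mainTerm k x - (x : ℂ) * mainDeriv k x)‖ := by
        congr 1; push_cast; ring
    _ ≤ _ := this
    _ = _ := by ring

/-- The contribution of the second-order terms of `x p_{k-1}(log x)`. -/
lemma exists_norm_sum_taylor_le (k : ℕ) {δ : ℝ} (h0 : 0 < δ) (h1 : δ ≤ 1 / 8) :
    ∃ C : ℝ, 0 < C ∧ ∀ (N : ℝ) (L : ℕ), 1 ≤ N →
      ‖∑ n ∈ Finset.Ioc ⌊N⌋₊ ⌊2 * N⌋₊, (divFun k n : ℂ) *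
        (mainTerm k (n + L : ℝ) - mainTerm k n - L * mainDeriv k n)‖ ≤
          C * N ^ (2 * δ) * (L : ℝ) ^ 2 := by
  obtain ⟨A, hA0, hA⟩ := exists_norm_mainTerm_taylor_le k h0 h1
  obtain ⟨B, hB0, hB⟩ := exists_divFun_le_range k h0 (by linarith)
  refine ⟨2 * B * A, by positivity, fun N L hN => ?_⟩
  have hN0 : 0 < N := by linarith
  calc _ ≤ ∑ n ∈ Finset.Ioc ⌊N⌋₊ ⌊2 * N⌋₊, B * N ^ δ * (A * N ^ (δ - 1) * (L : ℝ) ^ 2) := by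
        refine (norm_sum_le _ _).trans (Finset.sum_le_sum fun n hn => ?_)
        rw [norm_mul, Complex.norm_natCast]
        have := hA N n L hN (bounds_of_mem_range hN hn).1 (Nat.cast_nonneg L)
        rw [Complex.ofReal_natCast] at this
        exact mul_le_mul (hB N n hN hn) this (norm_nonneg _) (by positivity)
    _ ≤ 2 * N * (B * N ^ δ * (A * N ^ (δ - 1) * (L : ℝ) ^ 2)) := by
        rw [Finset.sum_const, nsmul_eq_mul]
        gcongr
        exact card_range_le hN
    _ = _ := by
        rw [two_mul δ, Real.rpow_add hN0, Real.rpow_sub_one hN0.ne']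
        field_simp

/-- Abel summation sums from `0`; the extra term vanishes because `divFun k 0 = 0`. -/
lemma divSum_eq_sum_Icc_zero (k : ℕ) (x : ℝ) :
    (divSum k x : ℂ) = ∑ n ∈ Finset.Icc 0 ⌊x⌋₊, (divFun k n : ℂ) := by
  unfold divSum
  rw [Nat.cast_sum, Finset.sum_subset (Finset.Icc_subset_Icc_left (Nat.zero_le 1))]
  intro n hn hn'
  have : n = 0 := by
    simp only [Finset.mem_Icc] at hn hn'
    omega
  rw [this, divFun_zero_right, Nat.cast_zero]

/-- Partial summation against the derivative of the main term. -/
lemma sum_divFun_mul_mainDeriv (k : ℕ) {N : ℝ} (hN : 1 ≤ N) :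
    ∑ n ∈ Finset.Ioc ⌊N⌋₊ ⌊2 * N⌋₊, (divFun k n : ℂ) * mainDeriv k n -
        ∫ x in N..(2 * N), mainDeriv k x ^ 2 =
      mainDeriv k (2 * N) * divErr k (2 * N) - mainDeriv k N * divErr k N -
        ∫ x in N..(2 * N), mainDeriv2 k x * divErr k x := by
  have hN2 : N ≤ 2 * N := by linarith
  have hpos : ∀ t ∈ Set.uIcc N (2 * N), 0 < t := fun t ht => by
    rw [Set.uIcc_of_le hN2] at ht; linarith [ht.1]
  have hpos' : ∀ t ∈ Set.Icc N (2 * N), 0 < t := fun t ht => by linarith [ht.1]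
  have c0 : ContinuousOn (mainTerm k) (Set.uIcc N (2 * N)) := fun t ht =>
    (hasDerivAt_mainTerm k (hpos t ht)).continuousAt.continuousWithinAt
  have c1 : ContinuousOn (mainDeriv k) (Set.uIcc N (2 * N)) := fun t ht =>
    (hasDerivAt_mainDeriv k (hpos t ht)).continuousAt.continuousWithinAt
  have c2 : ContinuousOn (mainDeriv2 k) (Set.uIcc N (2 * N)) := fun t ht =>
    (continuousAt_mainDeriv2 k (hpos t ht)).continuousWithinAt
  have hderiv : ∀ t ∈ Set.Icc N (2 * N), deriv (mainDeriv k) t = mainDeriv2 k t := fun t ht =>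
    (hasDerivAt_mainDeriv k (hpos' t ht)).deriv
  have habel := sum_mul_eq_sub_sub_integral_mul (fun n => (divFun k n : ℂ)) (f := mainDeriv k)
    (a := N) (b := 2 * N) (by linarith) hN2
    (fun t ht => (hasDerivAt_mainDeriv k (hpos' t ht)).differentiableAt)
    (((Set.uIcc_of_le hN2 ▸ c2).integrableOn_Icc).congr_fun (fun t ht => (hderiv t ht).symm)
      measurableSet_Icc)
  simp only [← divSum_eq_sum_Icc_zero] at habel
  have hint : ∫ t in Set.Ioc N (2 * N), deriv (mainDeriv k) t * (divSum k t : ℂ) =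
      ∫ t in N..(2 * N), mainDeriv2 k t * (divErr k t + mainTerm k t) := by
    rw [intervalIntegral.integral_of_le hN2]
    refine setIntegral_congr_fun measurableSet_Ioc fun t ht => ?_
    rw [hderiv t ⟨ht.1.le, ht.2⟩, divErr_eq, sub_add_cancel]
  have i1 : IntervalIntegrable (fun t => mainDeriv2 k t * divErr k t) volume N (2 * N) :=
    (intervalIntegrable_divErr k hN hN2).continuousOn_mul c2
  have i2 : IntervalIntegrable (fun t => mainDeriv2 k t * mainTerm k t) volume N (2 * N) :=
    (c2.mul c0).intervalIntegrable
  simp only [mul_add] at hint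
  rw [intervalIntegral.integral_add i1 i2] at hint
  -- Integration by parts writes `∫ M' M'` as the boundary terms of `M' M` minus `∫ M'' M`, so the
  -- part of the Abel summation in which `D_k` is replaced by `M` cancels exactly.
  have hparts := intervalIntegral.integral_mul_deriv_eq_deriv_mul
    (fun t ht => hasDerivAt_mainDeriv k (hpos t ht)) (fun t ht => hasDerivAt_mainTerm k (hpos t ht))
    c2.intervalIntegrable c1.intervalIntegrable
  simp only [pow_two]
  rw [hparts, Finset.sum_congr rfl fun n _ => mul_comm (divFun k n : ℂ) (mainDeriv k n), habel,
    hint, divErr_eq, divErr_eq]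
  ring

/-- The mean square gives no good bound for `Δ_k` at the endpoints `N` and `2N`. The factor `L`
helps: `L |Δ_k(x)|` is at most the integral of `|Δ_k|` over `[x, x + L]` plus `L²` up to `N^δ`, and
both fit the target. -/
lemma exists_norm_sum_mainDeriv_sub_le {k : ℕ} (hk : k ≠ 0) {b : ℝ} (hb : b ∈ betaSet k) {δ : ℝ}
    (h0 : 0 < δ) (h1 : δ ≤ 1 / 8) :
    ∃ C : ℝ, 0 < C ∧ ∀ (N : ℝ) (L : ℕ), 1 ≤ N → 1 ≤ L → (L : ℝ) ≤ N →
      ‖(L : ℂ) * (∑ n ∈ Finset.Ioc ⌊N⌋₊ ⌊2 * N⌋₊, (divFun k n : ℂ) * mainDeriv k n -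
        ∫ x in N..(2 * N), mainDeriv k x ^ 2)‖ ≤
          C * N ^ (2 * δ) * ((L : ℝ) ^ 2 + N ^ (1 + b)) := by
  obtain ⟨A, hA0, hA⟩ := exists_mul_norm_divErr_le k h0
  obtain ⟨B, hB0, hB⟩ := exists_integral_norm_divErr_le hk hb
  obtain ⟨D, hD0, hD⟩ := exists_norm_mainDeriv_le k h0 h1
  obtain ⟨E, hE0, hE⟩ := exists_norm_mainDeriv2_le k h0 h1
  set B' := B * 4 ^ (1 + b) with hB'
  refine ⟨2 * (D * 4 * (B' + A * 4)) + E * B', by positivity, fun N L hN hL1 hLN => ?_⟩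
  have hN0 : 0 < N := by linarith
  have hN2 : N ≤ 2 * N := by linarith
  have hL1' : (1 : ℝ) ≤ L := by exact_mod_cast hL1
  have hNδ : 1 ≤ N ^ δ := Real.one_le_rpow hN h0.le
  have hJ : ∀ a c : ℝ, 1 ≤ a → a ≤ c → c ≤ 4 * N →
      ∫ x in a..c, ‖divErr k x‖ ≤ B' * N ^ (1 + b) := by
    intro a c ha hac hc
    calc _ ≤ ∫ x in (1 : ℝ)..(4 * N), ‖divErr k x‖ :=
          intervalIntegral.integral_mono_interval ha hac hc
            (Eventually.of_forall fun _ => norm_nonneg _)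
            (intervalIntegrable_divErr k le_rfl (by linarith)).norm
      _ ≤ B * (4 * N) ^ (1 + b) := hB _ (by linarith)
      _ = _ := by rw [Real.mul_rpow (by norm_num) hN0.le, hB']; ring
  have hpoint : ∀ x : ℝ, N ≤ x → x ≤ 2 * N → L * ‖mainDeriv k x * divErr k x‖ ≤
      D * 4 * (B' + A * 4) * N ^ (2 * δ) * ((L : ℝ) ^ 2 + N ^ (1 + b)) := by
    intro x hx1 hx2
    have e1 := hA x L (4 * N) (by linarith) hL1' (by linarith)
    have e2 := hJ x (x + L) (by linarith) (by linarith) (by linarith)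
    have e3 : ‖mainDeriv k x‖ ≤ D * (4 * N ^ δ) :=
      (hD x (by linarith)).trans (by
        gcongr
        exact (Real.rpow_le_rpow (by linarith) (by linarith) h0.le).trans
          (four_mul_rpow_le hN0.le (by linarith)))
    have e4 : (L : ℝ) * ‖divErr k x‖ ≤
        (B' + A * 4) * N ^ δ * ((L : ℝ) ^ 2 + N ^ (1 + b)) := by
      calc _ ≤ B' * N ^ (1 + b) + A * (4 * N ^ δ) * (L : ℝ) ^ 2 := by
            refine e1.trans (add_le_add e2 ?_)
            gcongr
            exact four_mul_rpow_le hN0.le (by linarith)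
        _ ≤ B' * N ^ (1 + b) * N ^ δ + A * (4 * N ^ δ) * (L : ℝ) ^ 2 := by
            gcongr ?_ + _
            exact le_mul_of_one_le_right (by positivity) hNδ
        -- Nonnegative cross terms are added so that the sum factors as a product.
        _ ≤ B' * N ^ (1 + b) * N ^ δ + A * (4 * N ^ δ) * (L : ℝ) ^ 2 +
            (B' * N ^ δ * (L : ℝ) ^ 2 + A * 4 * N ^ δ * N ^ (1 + b)) :=
            le_add_of_nonneg_right (by positivity)
        _ = _ := by ring
    rw [norm_mul]
    calc (L : ℝ) * (‖mainDeriv k x‖ * ‖divErr k x‖)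
        = ‖mainDeriv k x‖ * (L * ‖divErr k x‖) := by ring
      _ ≤ D * (4 * N ^ δ) * ((B' + A * 4) * N ^ δ * ((L : ℝ) ^ 2 + N ^ (1 + b))) := by
          gcongr
      _ = _ := by rw [two_mul δ, Real.rpow_add hN0 δ δ]; ring
  have hintegral : L * ‖∫ x in N..(2 * N), mainDeriv2 k x * divErr k x‖ ≤
      E * B' * N ^ (2 * δ) * ((L : ℝ) ^ 2 + N ^ (1 + b)) := by
    have e1 : ‖∫ x in N..(2 * N), mainDeriv2 k x * divErr k x‖ ≤
        ∫ x in N..(2 * N), E * N ^ (δ - 1) * ‖divErr k x‖ := by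
      refine intervalIntegral.norm_integral_le_of_norm_le hN2
        (Eventually.of_forall fun x hx => ?_)
        ((intervalIntegrable_divErr k hN hN2).norm.const_mul _)
      rw [norm_mul]
      gcongr
      refine (hE x (by linarith [hx.1])).trans ?_
      gcongr E * ?_
      exact Real.rpow_le_rpow_of_nonpos hN0 hx.1.le (by linarith)
    rw [intervalIntegral.integral_const_mul] at e1
    calc _ ≤ N * (E * N ^ (δ - 1) * (B' * N ^ (1 + b))) := by
          gcongr
          refine e1.trans ?_
          gcongr
          exact hJ _ _ hN hN2 (by linarith)
      _ = E * B' * N ^ δ * N ^ (1 + b) := by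
          rw [Real.rpow_sub_one hN0.ne']; field_simp
      _ ≤ _ := by
          gcongr
          · linarith
          · exact le_add_of_nonneg_left (by positivity)
  rw [sum_divFun_mul_mainDeriv k hN, norm_mul, Complex.norm_natCast]
  calc _ ≤ (L : ℝ) * (‖mainDeriv k (2 * N) * divErr k (2 * N)‖ + ‖mainDeriv k N * divErr k N‖ +
          ‖∫ x in N..(2 * N), mainDeriv2 k x * divErr k x‖) := by
        gcongr
        exact (norm_sub_le _ _).trans (by gcongr; exact norm_sub_le _ _)
    _ = L * ‖mainDeriv k (2 * N) * divErr k (2 * N)‖ + L * ‖mainDeriv k N * divErr k N‖ +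
          L * ‖∫ x in N..(2 * N), mainDeriv2 k x * divErr k x‖ := by ring
    _ ≤ _ := by
        have e1 := hpoint (2 * N) hN2 le_rfl
        have e2 := hpoint N le_rfl hN2
        linarith

lemma exists_norm_integral_singSeries_sub_le (k : ℕ) {δ : ℝ} (h0 : 0 < δ) (h1 : δ ≤ 1 / 8) :
    ∃ C : ℝ, 0 < C ∧ ∀ (N : ℝ) (L : ℕ), 1 ≤ N → (L : ℝ) ≤ N →
      ‖(∑ h ∈ Finset.Icc 1 L, ∫ x in N..(2 * N), singSeries k x h) -
        L * ∫ x in N..(2 * N), mainDeriv k x ^ 2‖ ≤ C * N ^ (2 * δ) * N := by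
  obtain ⟨A, hA0, hA⟩ := exists_norm_sum_singSeries_sub_le k h0 (by linarith)
  refine ⟨4 * A, by positivity, fun N L hN hL => ?_⟩
  have hN0 : 0 < N := by linarith
  have hN2 : N ≤ 2 * N := by linarith
  have hI : ∀ h ∈ Finset.Icc 1 L,
      IntervalIntegrable (fun x => singSeries k x h) volume N (2 * N) := by
    intro h hh
    refine ContinuousOn.intervalIntegrable ((continuousOn_singSeries k ?_ (2 * N)).mono ?_)
    · have := (Finset.mem_Icc.1 hh).1; omega
    · rw [Set.uIcc_of_le hN2]
      exact Set.Icc_subset_Icc_left hN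
  have hM : IntervalIntegrable (fun x => (L : ℂ) * mainDeriv k x ^ 2) volume N (2 * N) := by
    refine ContinuousOn.intervalIntegrable fun t ht => ?_
    rw [Set.uIcc_of_le hN2] at ht
    exact (continuousAt_const.mul ((hasDerivAt_mainDeriv k
      (by linarith [ht.1])).continuousAt.pow 2)).continuousWithinAt
  rw [← intervalIntegral.integral_finsetSum hI, ← intervalIntegral.integral_const_mul,
    ← intervalIntegral.integral_sub
      (by simpa only [Finset.sum_fn] using IntervalIntegrable.sum _ hI) hM]
  have := intervalIntegral.norm_integral_le_of_norm_le_const (a := N) (b := 2 * N)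
    (f := fun x => (∑ h ∈ Finset.Icc 1 L, singSeries k x h) - L * mainDeriv k x ^ 2)
    (C := 4 * A * N ^ (2 * δ)) fun x hx => by
      rw [Set.uIoc_of_le hN2] at hx
      calc _ ≤ A * x ^ δ * (L : ℝ) ^ δ := hA L x (by linarith [hx.1])
        _ ≤ A * (4 * N ^ δ) * N ^ δ := by
          gcongr
          exact (Real.rpow_le_rpow (by linarith [hx.1]) (by linarith [hx.2]) h0.le).trans
            (four_mul_rpow_le hN0.le (by linarith))
        _ = _ := by rw [two_mul δ, Real.rpow_add hN0 δ δ]; ring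
  calc _ ≤ _ := this
    _ = _ := by rw [show 2 * N - N = N by ring, abs_of_pos hN0]

theorem exists_norm_sum_corrErr_le {k : ℕ} (hk : k ≠ 0) {b : ℝ} (hb : b ∈ betaSet k) {δ : ℝ}
    (h0 : 0 < δ) (h1 : δ ≤ 1 / 8) :
    ∃ C : ℝ, 0 < C ∧ ∀ (N : ℝ) (L : ℕ), 1 ≤ N → 1 ≤ L → (L : ℝ) ≤ N →
      ‖∑ h ∈ Finset.Icc 1 L, corrErr k N h‖ ≤
        C * N ^ (2 * δ) * ((L : ℝ) ^ 2 + N ^ (1 + b)) := by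
  obtain ⟨C₁, hC₁, b₁⟩ := exists_norm_sum_divErr_le hk hb h0 (by linarith)
  obtain ⟨C₂, hC₂, b₂⟩ := exists_norm_sum_taylor_le k h0 h1
  obtain ⟨C₃, hC₃, b₃⟩ := exists_norm_sum_mainDeriv_sub_le hk hb h0 h1
  obtain ⟨C₄, hC₄, b₄⟩ := exists_norm_integral_singSeries_sub_le k h0 h1
  have hb0 := nonneg_of_mem_betaSet hk hb
  refine ⟨C₁ + C₂ + C₃ + C₄, by positivity, fun N L hN hL hLN => ?_⟩
  have hN0 : 0 < N := by linarith
  have e1 := b₁ N L hN hLN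
  have e2 := b₂ N L hN
  have e3 := b₃ N L hN hL hLN
  have e4 := b₄ N L hN hLN
  set T₁ := ∑ n ∈ Finset.Ioc ⌊N⌋₊ ⌊2 * N⌋₊,
    (divFun k n : ℂ) * (divErr k (n + L : ℝ) - divErr k n)
  set T₂ := ∑ n ∈ Finset.Ioc ⌊N⌋₊ ⌊2 * N⌋₊, (divFun k n : ℂ) *
    (mainTerm k (n + L : ℝ) - mainTerm k n - L * mainDeriv k n)
  set S := ∑ n ∈ Finset.Ioc ⌊N⌋₊ ⌊2 * N⌋₊, (divFun k n : ℂ) * mainDeriv k n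
  set I := ∫ x in N..(2 * N), mainDeriv k x ^ 2
  set G := ∑ h ∈ Finset.Icc 1 L, ∫ x in N..(2 * N), singSeries k x h
  -- `L * I` is the common main term, inserted once on each side.
  have hdec : ∑ h ∈ Finset.Icc 1 L, corrErr k N h = T₁ + T₂ + L * (S - I) - (G - L * I) := by
    have h2 : ((∑ h ∈ Finset.Icc 1 L, corrSum k N h : ℕ) : ℂ) = T₁ + T₂ + L * S := by
      rw [sum_corrSum]
      simp only [T₁, T₂, S, Finset.mul_sum, ← Finset.sum_add_distrib]
      refine Finset.sum_congr rfl fun n _ => ?_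
      rw [divErr_eq, divErr_eq]
      ring
    unfold corrErr
    rw [Finset.sum_sub_distrib, ← Nat.cast_sum, h2]
    ring
  rw [hdec]
  have hNN : N ≤ N ^ (1 + b) := by
    calc N = N ^ (1 : ℝ) := (Real.rpow_one N).symm
      _ ≤ _ := Real.rpow_le_rpow_of_exponent_le hN (by linarith)
  set P := (L : ℝ) ^ 2 + N ^ (1 + b)
  have hP1 : N ^ (1 + b) ≤ P := le_add_of_nonneg_left (by positivity)
  have hP2 : (L : ℝ) ^ 2 ≤ P := le_add_of_nonneg_right (by positivity)
  calc _ ≤ ‖T₁‖ + ‖T₂‖ + ‖L * (S - I)‖ + ‖G - L * I‖ :=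
        (norm_sub_le _ _).trans (add_le_add_left ((norm_add_le _ _).trans
          (add_le_add_left (norm_add_le _ _) _)) _)
    _ ≤ C₁ * N ^ (2 * δ) * P + C₂ * N ^ (2 * δ) * P + C₃ * N ^ (2 * δ) * P +
          C₄ * N ^ (2 * δ) * P := by
        gcongr
        · exact e1.trans (by gcongr)
        · exact e2.trans (by gcongr)
        · exact e4.trans (by gcongr; linarith)
    _ = _ := by ring

end AdditiveDivisor

end

theorem theorem1 (k : ℕ) (hk : 3 ≤ k) (ε : ℝ) (hε : 0 < ε) :
    ∃ C : ℝ, ∀ N H : ℝ, 1 ≤ H → H ≤ N →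
      ‖∑ h ∈ Finset.Icc 1 ⌊H⌋₊, AdditiveDivisor.corrErr k N h‖
        ≤ C * (N ^ ε * (H ^ 2 + N ^ (1 + AdditiveDivisor.beta k))) := by
  -- Half of `ε` pays for replacing `β_k` by `b < β_k + ε/2`, the other half for `N^(2δ)` with `δ ≤
  -- ε/4`.
  obtain ⟨b, hb, hlt⟩ := AdditiveDivisor.exists_mem_betaSet_lt k (half_pos hε)
  have hδ : 0 < min (ε / 4) (1 / 8) := by positivity
  obtain ⟨C, hC0, hC⟩ := AdditiveDivisor.exists_norm_sum_corrErr_le (by omega) hb hδ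
    (min_le_right _ _)
  refine ⟨C, fun N H hH hHN => ?_⟩
  have hN : 1 ≤ N := hH.trans hHN
  have hN0 : 0 < N := by linarith
  have hLH : (⌊H⌋₊ : ℝ) ≤ H := Nat.floor_le (by linarith)
  refine (hC N ⌊H⌋₊ hN (Nat.le_floor (by exact_mod_cast hH)) (hLH.trans hHN)).trans ?_
  rw [mul_assoc]
  gcongr C * ?_
  have e1 : N ^ (2 * min (ε / 4) (1 / 8)) ≤ N ^ (ε / 2) :=
    Real.rpow_le_rpow_of_exponent_le hN (by linarith [min_le_left (ε / 4) (1 / 8)])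
  have e2 : N ^ (1 + b) ≤ N ^ (ε / 2) * N ^ (1 + AdditiveDivisor.beta k) := by
    rw [← Real.rpow_add hN0]
    exact Real.rpow_le_rpow_of_exponent_le hN (by linarith)
  have e3 : (⌊H⌋₊ : ℝ) ^ 2 ≤ N ^ (ε / 2) * H ^ 2 :=
    (pow_le_pow_left₀ (Nat.cast_nonneg _) hLH 2).trans
      (le_mul_of_one_le_left (by positivity) (Real.one_le_rpow hN (by linarith)))
  calc _ ≤ N ^ (ε / 2) *
        (N ^ (ε / 2) * H ^ 2 + N ^ (ε / 2) * N ^ (1 + AdditiveDivisor.beta k)) := by gcongr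
    _ = N ^ (ε / 2 + ε / 2) * (H ^ 2 + N ^ (1 + AdditiveDivisor.beta k)) := by
        rw [Real.rpow_add hN0 (ε / 2) (ε / 2)]; ring
    _ = _ := by rw [add_halves]
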